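/- **Notation.** For complex $a,q$ and an integer $k\ge 0$ let $(a;q)_k=\prod_{s=0}^{k-1}(1-aq^s)$ and, for $k\ge1$, $(a;q)_{-k}=1/(aq^{-k};q)_k$; let $(a_1,\dots,a_r;q)_k=\prod_{i}(a_i;q)_k$. Let $N\ge 0$ be an integer and let $q,\alpha,\gamma,\gamma',c$ be nonzero complex numbers such that no denominator below vanishes for $x,y,m,n\ge0$ with $x+y\le N$, $m+n\le N$. Explicitly: - $q^k\ne1$ for $1\le k\le N$; - $\alpha q^k\neq1$ and $\alpha q^{2k}\ne1$ for $0\le k\le N$; - $\gamma q^k\ne1$, $\gamma'q^k\neq1$ and $\frac{\gamma'}{c}q^k\ne1$ for $0\le k<N$; - $\frac{\alpha c}{\gamma'}q^k\neq1$ for $1\le k\le N$; - $\frac{\gamma\gamma'}{\alpha}\ne q^k$ for $1\le k\le 2N$; - $cq^k\ne1$ for $-2N<k\le N$, and $c\ne q^N$; - $\frac{\gamma\gamma'}{\alpha c}q^k\ne1$ for $-2N\le k<N$, and $\frac{\gamma\gamma'}{\alpha c}\neq q^{N+1}$. Define $$w_N(x,y)=\frac{(\alpha q/\gamma\gamma',\gamma'/c,\alpha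 cq/\gamma';q)_N}{(\alpha q,1/c,\alpha cq/\gamma\gamma';q)_N}\cdot\frac{\left(1-\frac{\gamma\gamma'q^{2x-N-1}}{\alpha c}\right)(1-cq^{2y-N})\left(\frac{\gamma\gamma'q^{-N-1}}{\alpha c},\gamma;q\right)_x(cq^{-N},\gamma';q)_y}{\left(1-\frac{\gamma\gamma'q^{-N-1}}{\alpha c}\right)(1-cq^{-N})\left(q,\frac{\gamma'q^{-N}}{\alpha c};q\right)_x\left(q,\frac{cq^{1-N}}{\gamma'};q\right)_y}$$ $$\qquad\times\frac{(1/c;q)_{x-y}\,(q^{-N};q)_{x+y}}{\left(\frac{\gamma\gamma'}{\alpha c};q\right)_{x-y}\left(\frac{\gamma\gamma'q^{-N}}{\alpha};q\right)_{x+y}}\,\alpha^{-x}(\gamma')^{x-y},$$ $$F_{m,n}(x,y)=\frac{\left(\frac{\alpha q^{N+1-x-y}}{\gamma\gamma'};q\right)_{m+n}\left(q^{x-y}/c;q\right)_n\left(\alpha cq^{1+y-x}/\gamma\gamma';q\right)_m}{(q^{-N};q)_{m+n}(\alpha cq/\gamma\gamma';q)_n(1/c;q)_m}\,c^{n-m}q^{mx+ny+mn}$$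 $$\qquad\times\sum_{i=0}^m\sum_{j=0}^n\frac{\left(q^{-m},\gamma q^x,\frac{\gamma\gamma'q^{x-N-1}}{\alpha c};q\right)_i\left(q^{-n},\gamma'q^y,cq^{y-N};q\right)_j\left(\frac{\gamma\gamma'q^{-m-n}}{\alpha};q\right)_{i+j}}{\left(q,\gamma,\frac{\gamma\gamma'q^{x-y-m}}{\alpha c};q\right)_i\left(q,\gamma',cq^{1+y-x-n};q\right)_j\left(\frac{\gamma\gamma'q^{x+y-N-m-n}}{\alpha};q\right)_{i+j}}\,q^{i+j},$$ $$G_{m,n}(x,y)=\sum_{i=0}^m\sum_{j=0}^n\frac{\left(q^{-m},q^{-x},\frac{\gamma\gamma'q^{x-N-1}}{\alpha c};q\right)_i\left(q^{-n},q^{-y},cq^{y-N};q\right)_j(\alpha q^{m+n};q)_{i+j}}{\left(q,\gamma,\gamma'q^n/c;q\right)_i\left(q,\gamma',\alpha cq^{m+1}/\gamma';q\right)_j(q^{-N};q)_{i+j}}\,q^{i+j},$$ $$\nu_{m,n}=\frac{1-\alpha}{1-\alpha q^{2m+2n}}\cdot\frac{(q,\alpha cq/\gamma';q)_m(q,\gamma'/c;q)_n(\alpha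 q/\gamma\gamma',\alpha q^{N+1};q)_{m+n}}{(\gamma,1/c;q)_m(\gamma',\alpha cq/\gamma\gamma';q)_n(\alpha,q^{-N};q)_{m+n}}\,c^{n-m}q^{mn}.$$ **Theorem.** For all integers $m,n,m',n'\ge0$ with $m+n\le N$ and $m'+n'\le N$, $$\sum_{x=0}^N\sum_{y=0}^N w_N(x,y)\,F_{m,n}(x,y)\,G_{m',n'}(x,y)=\nu_{m,n}\,\delta_{m,m'}\,\delta_{n,n'},$$ where the terms with $x+y>N$ are $0$ because of the factor $(q^{-N};q)_{x+y}$ of the weight. -/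

import Mathlib

open scoped BigOperators

noncomputable section

namespace QRacah2

/-- The `q`-shifted factorial `(a;q)_n = (1 - a)(1 - a q)⋯(1 - a q^(n-1))`, for `n : ℕ`. -/
def qPoch (a q : ℂ) (n : ℕ) : ℂ := ∏ k ∈ Finset.range n, (1 - a * q ^ k)

/-- Compact notation `(a₁, …, a_r;q)_n = (a₁;q)_n ⋯ (a_r;q)_n`. -/
def qPochs (l : List ℂ) (q : ℂ) (n : ℕ) : ℂ := (l.map fun a => qPoch a q n).prod

/-- The `q`-shifted factorial with integer index; `(a;q)_{-k} = 1 / (a q^{-k};q)_k` for `k ≥ 1`. -/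
def qPochZ (a q : ℂ) : ℤ → ℂ
  | Int.ofNat n => qPoch a q n
  | Int.negSucc n => 1 / qPoch (a * q ^ (-((n : ℤ) + 1))) q (n + 1)

/-- The weight function `w_N(x,y)`. -/
def weight (q α γ γ' c : ℂ) (N x y : ℕ) : ℂ :=
  qPochs [α * q / (γ * γ'), γ' / c, α * c * q / γ'] q N /
      qPochs [α * q, 1 / c, α * c * q / (γ * γ')] q N
    * (((1 - γ * γ' * q ^ (2 * (x : ℤ) - N - 1) / (α * c)) * (1 - c * q ^ (2 * (y : ℤ) - N))
          * qPochs [γ * γ' * q ^ (-(N : ℤ) - 1) / (α * c), γ] q x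
          * qPochs [c * q ^ (-(N : ℤ)), γ'] q y)
        / ((1 - γ * γ' * q ^ (-(N : ℤ) - 1) / (α * c)) * (1 - c * q ^ (-(N : ℤ)))
          * qPochs [q, γ' * q ^ (-(N : ℤ)) / (α * c)] q x
          * qPochs [q, c * q ^ (1 - (N : ℤ)) / γ'] q y))
    * ((qPochZ (1 / c) q ((x : ℤ) - y) * qPoch (q ^ (-(N : ℤ))) q (x + y))
        / (qPochZ (γ * γ' / (α * c)) q ((x : ℤ) - y)
          * qPoch (γ * γ' * q ^ (-(N : ℤ)) / α) q (x + y)))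
    * α ^ (-(x : ℤ)) * γ' ^ ((x : ℤ) - y)

/-- The function `F_{m,n}(x,y)`. -/
def F (q α γ γ' c : ℂ) (N m n x y : ℕ) : ℂ :=
  (qPoch (α * q ^ ((N : ℤ) + 1 - x - y) / (γ * γ')) q (m + n)
        * qPoch (q ^ ((x : ℤ) - y) / c) q n
        * qPoch (α * c * q ^ (1 + (y : ℤ) - x) / (γ * γ')) q m)
      / (qPoch (q ^ (-(N : ℤ))) q (m + n) * qPoch (α * c * q / (γ * γ')) q n * qPoch (1 / c) q m)
    * c ^ ((n : ℤ) - m) * q ^ (m * x + n * y + m * n)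
    * ∑ i ∈ Finset.range (m + 1), ∑ j ∈ Finset.range (n + 1),
        (qPochs [q ^ (-(m : ℤ)), γ * q ^ x, γ * γ' * q ^ ((x : ℤ) - N - 1) / (α * c)] q i
            * qPochs [q ^ (-(n : ℤ)), γ' * q ^ y, c * q ^ ((y : ℤ) - N)] q j
            * qPoch (γ * γ' * q ^ (-(m : ℤ) - n) / α) q (i + j))
          / (qPochs [q, γ, γ * γ' * q ^ ((x : ℤ) - y - m) / (α * c)] q i
            * qPochs [q, γ', c * q ^ (1 + (y : ℤ) - x - n)] q j
            * qPoch (γ * γ' * q ^ ((x : ℤ) + y - N - m - n) / α) q (i + j))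
          * q ^ (i + j)

/-- The function `G_{m,n}(x,y)`. -/
def G (q α γ γ' c : ℂ) (N m n x y : ℕ) : ℂ :=
  ∑ i ∈ Finset.range (m + 1), ∑ j ∈ Finset.range (n + 1),
    (qPochs [q ^ (-(m : ℤ)), q ^ (-(x : ℤ)), γ * γ' * q ^ ((x : ℤ) - N - 1) / (α * c)] q i
        * qPochs [q ^ (-(n : ℤ)), q ^ (-(y : ℤ)), c * q ^ ((y : ℤ) - N)] q j
        * qPoch (α * q ^ (m + n)) q (i + j))
      / (qPochs [q, γ, γ' * q ^ n / c] q i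
        * qPochs [q, γ', α * c * q ^ (m + 1) / γ'] q j
        * qPoch (q ^ (-(N : ℤ))) q (i + j))
      * q ^ (i + j)

/-- The normalization constant `ν_{m,n}`. -/
def nu (q α γ γ' c : ℂ) (N m n : ℕ) : ℂ :=
  (1 - α) / (1 - α * q ^ (2 * m + 2 * n))
    * ((qPochs [q, α * c * q / γ'] q m * qPochs [q, γ' / c] q n
          * qPochs [α * q / (γ * γ'), α * q ^ (N + 1)] q (m + n))
        / (qPochs [γ, 1 / c] q m * qPochs [γ', α * c * q / (γ * γ')] q n
          * qPochs [α, q ^ (-(N : ℤ))] q (m + n)))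
    * c ^ ((n : ℤ) - m) * q ^ (m * n)

/-- No denominator in `w_N(x,y)`, `F_{m,n}(x,y)`, `G_{m,n}(x,y)` and `ν_{m,n}` vanishes, for all
`x + y ≤ N` and `m + n ≤ N`. The fields list the linear factors of these denominators. -/
structure Admissible (q α γ γ' c : ℂ) (N : ℕ) : Prop where
  q_ne : q ≠ 0
  alpha_ne : α ≠ 0
  gamma_ne : γ ≠ 0
  gamma'_ne : γ' ≠ 0
  c_ne : c ≠ 0
  q_pow : ∀ k : ℕ, 1 ≤ k → k ≤ N → q ^ k ≠ 1
  alpha_pow : ∀ k : ℕ, k ≤ N → α * q ^ k ≠ 1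
  alpha_pow_two : ∀ k : ℕ, k ≤ N → α * q ^ (2 * k) ≠ 1
  gamma_pow : ∀ k : ℕ, k < N → γ * q ^ k ≠ 1
  gamma'_pow : ∀ k : ℕ, k < N → γ' * q ^ k ≠ 1
  gamma'_div_c : ∀ k : ℕ, k < N → γ' / c * q ^ k ≠ 1
  alpha_c_div : ∀ k : ℕ, 1 ≤ k → k ≤ N → α * c / γ' * q ^ k ≠ 1
  gammas_div_alpha : ∀ k : ℕ, 1 ≤ k → k ≤ 2 * N → γ * γ' / α ≠ q ^ k
  c_pow : ∀ k : ℤ, -2 * (N : ℤ) < k → k ≤ N → c * q ^ k ≠ 1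
  c_ne_pow : c ≠ q ^ N
  gammas_div_alpha_c : ∀ k : ℤ, -2 * (N : ℤ) ≤ k → k < N → γ * γ' / (α * c) * q ^ k ≠ 1
  gammas_div_alpha_c_ne : γ * γ' / (α * c) ≠ q ^ (N + 1)

end QRacah2

end

/-! Put `q = e^{2h}`, `α = e^{2a}`, `γ = e^{2g}`, `γ' = e^{2p}`, and write `e^{2c}` for the original
`c`. A factor `1 - e^{2z}` is an exponential times the odd bracket `sh z`, so the powers of `q`
separate from the real content. For generic parameters every shifted factorial is a quotient `f (j +
n) / f j` of values of a nonvanishing sequence on `ℤ` (`IsGam`), which makes negative indices and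
reflections uniform.

The core is a moment computation. `G_{m',n'}` is a combination, over `k ≤ m'` and `l ≤ n'`, of
products `bas` of a function of `x` and a function of `y`. The sum of `w F_{m,n}` against such a
product has a closed form (`moment`). Sears' transformation (`sears`) rewrites the `i`-sum inside
`F` so that the sum over `x` becomes a very-well-poised `6φ5` (`vwp`), after which the `i`-sum is a
`q`-Saalschütz sum (`saal`). The same three steps then remove `j` and `y`. The result contains
reciprocal factorials of `k - m` and `l - n`, hence vanishes unless `m ≤ k` and `n ≤ l`. Pairing the
moments with the coefficients of `G` leaves a double sum over `m ≤ k ≤ m'`, `n ≤ l ≤ n'`, which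
Saalschütz reduces to a Kronecker delta (`connection`).

The two summation formulas are proved by induction with a telescoping certificate, and Sears follows
from Saalschütz by interchanging sums.

Genericity is removed at the end. Along a suitable complex line through the given parameters only
countably many points are not generic, and both sides are continuous at the given point because no
denominator vanishes there. -/

noncomputable section

namespace QRacah2

/-! ### Symmetric brackets and shifted factorials as sequences on the integers -/

/-- The symmetric bracket `2 sinh z`. -/
def sh (z : ℂ) : ℂ := Complex.exp z - Complex.exp (-z)

lemma sh_neg (z : ℂ) : sh (-z) = -sh z := by simp [sh]

lemma sh_zero : sh 0 = 0 := by simp [sh]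

/-- `f` is a nonvanishing solution of the first order recurrence of the symmetric shifted
factorial with base `z` and step `h`. -/
structure IsGam (h z : ℂ) (f : ℤ → ℂ) : Prop where
  ne : ∀ k, f k ≠ 0
  succ : ∀ k, f (k + 1) = sh (z + k * h) * f k

/-- The symmetric shifted factorial. -/
def symPoch (h z : ℂ) (n : ℕ) : ℂ := ∏ k ∈ Finset.range n, sh (z + k * h)

/-- The reciprocal of the symmetric factorial, extended by zero. -/
def rfact (h : ℂ) (n : ℤ) : ℂ := if n < 0 then 0 else (symPoch h h n.toNat)⁻¹

variable {h : ℂ}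

lemma symPoch_succ (z : ℂ) (n : ℕ) : symPoch h z (n + 1) = symPoch h z n * sh (z + n * h) := by
  simp [symPoch, Finset.prod_range_succ]

lemma symPoch_zero (z : ℂ) : symPoch h z 0 = 1 := by simp [symPoch]

lemma rfact_zero : rfact h 0 = 1 := by simp [rfact, symPoch]

lemma rfact_neg {n : ℤ} (hn : n < 0) : rfact h n = 0 := by simp [rfact, hn]

lemma rfact_ne (hq : ∀ k : ℕ, 1 ≤ k → sh (k * h) ≠ 0) {n : ℤ} (hn : 0 ≤ n) : rfact h n ≠ 0 := by
  rw [rfact, if_neg (by omega)]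
  refine inv_ne_zero (Finset.prod_ne_zero_iff.2 fun k _ => ?_)
  have := hq (k + 1) (by omega)
  push_cast at this
  rwa [add_mul, one_mul, add_comm] at this

/-- The extension by zero is what makes this recurrence valid for every integer: at `n = 0` both
sides vanish because `sh 0 = 0`. Sums then have natural boundaries, and telescoping needs no
separate end terms. -/
lemma rfact_pred (hq : ∀ k : ℕ, 1 ≤ k → sh (k * h) ≠ 0) (n : ℤ) :
    rfact h (n - 1) = sh (n * h) * rfact h n := by
  rcases lt_trichotomy n 0 with hn | rfl | hn
  · rw [rfact_neg hn, rfact_neg (by omega), mul_zero]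
  · rw [rfact_neg (by omega)]; simp [sh_zero]
  · obtain ⟨m, rfl⟩ : ∃ m : ℕ, n = m + 1 := ⟨(n - 1).toNat, by omega⟩
    have := hq (m + 1) (by omega)
    have e : h + m * h = ((m : ℂ) + 1) * h := by ring
    push_cast at this ⊢
    rw [add_sub_cancel_right, rfact, rfact, if_neg (by omega), if_neg (by omega)]
    rw [show ((m : ℤ) + 1).toNat = m + 1 by omega, Int.toNat_natCast, symPoch_succ, e]
    field_simp

namespace IsGam

variable {z w : ℂ} {f : ℤ → ℂ}

lemma shift (hf : IsGam h z f) (j : ℤ) (hw : w = z + j * h) : IsGam h w fun k => f (j + k) where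
  ne k := hf.ne _
  succ k := by
    have := hf.succ (j + k)
    rw [← add_assoc, this, hw]
    push_cast; ring_nf

/-- Reflection: running a sequence backwards and inverting it negates the base, and the sign `(-1) ^
k` accounts for the oddness of `sh`. Thus one sequence serves both a base and its negative. -/
lemma neg (hf : IsGam h z f) (j : ℤ) (hw : w = -z + (1 - j) * h) :
    IsGam h w fun k => (-1) ^ k / f (j - k) where
  ne k := div_ne_zero (zpow_ne_zero _ (by norm_num)) (hf.ne _)
  succ k := by
    have h1 := hf.succ (j - (k + 1))
    rw [show j - (k + 1) + 1 = j - k by ring] at h1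
    have h2 := hf.ne (j - (k + 1))
    have h3 := hf.ne (j - k)
    rw [h1] at h3
    have h4 : sh (z + (j - (k + 1) : ℤ) * h) ≠ 0 := left_ne_zero_of_mul h3
    have h5 : sh (w + k * h) = -sh (z + (j - (k + 1) : ℤ) * h) := by
      rw [← sh_neg, hw]; push_cast; ring_nf
    rw [h5, h1, zpow_add₀ (by norm_num)]
    field_simp

lemma symPoch_eq (hf : IsGam h z f) (n : ℕ) : symPoch h z n = f n / f 0 := by
  have := hf.ne 0
  induction n with
  | zero => simp [symPoch, this]
  | succ n ih =>
    rw [symPoch_succ, ih]; push_cast; rw [hf.succ]; push_cast; ring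

lemma symPoch_shift (hf : IsGam h z f) (j : ℤ) (n : ℕ) (hw : w = z + j * h) :
    symPoch h w n = f (j + n) / f j := by
  rw [(hf.shift j hw).symPoch_eq]; simp

lemma symPoch_neg (hf : IsGam h z f) (j : ℤ) (n : ℕ) (hw : w = -z + (1 - j) * h) :
    symPoch h w n = (-1) ^ n * f j / f (j - n) := by
  rw [(hf.neg j hw).symPoch_eq]; simp; field_simp

end IsGam

lemma sum_range_shift (f : ℕ → ℂ) (n j : ℕ) (hj : j ≤ n) (hf : ∀ i < j, f i = 0) :
    ∑ i ∈ Finset.range (n + 1), f i = ∑ t ∈ Finset.range (n - j + 1), f (j + t) := by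
  obtain ⟨m, rfl⟩ := Nat.exists_eq_add_of_le hj
  rw [show j + m + 1 = j + (m + 1) by ring, Finset.sum_range_add,
    Finset.sum_eq_zero (s := Finset.range j) (fun i hi => hf i (Finset.mem_range.1 hi)),
    zero_add, show j + m - j = m by omega]

/-! ### The `q`-Saalschütz sum -/

/-- The telescoping certificate for `saal` with the common summand divided out; here `p = n h`, `r =
k h`, and the balancing condition turns `-(C - A - B + p - r)` into `D + k h`. -/
lemma saal_identity (A B C p r h : ℂ) :
    -(sh (p + h) * sh (-(C - A - B + p - r)) * sh (C + p)) =
      sh (p + h - r) * (sh (C - A + p) * sh (C - B + p) - sh (A + r) * sh (B + r))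
        - sh r * sh (C + r - h) * sh (-(C - A - B + p - r)) := by
  simp only [sh, Complex.exp_add, Complex.exp_sub, Complex.exp_neg, neg_add, neg_sub]
  field_simp
  ring

/-- The `q`-Saalschütz sum. -/
theorem saal (hq : ∀ k : ℕ, 1 ≤ k → sh (k * h) ≠ 0) {A B C : ℂ} {fA fB fC : ℤ → ℂ}
    (hA : IsGam h A fA) (hB : IsGam h B fB) (hC : IsGam h C fC) (n : ℕ) :
    ∀ {D : ℂ} {fD : ℤ → ℂ}, IsGam h D fD → A + B + h - n * h = C + D →
    ∑ k ∈ Finset.range (n + 1), (-1) ^ k * rfact h k * rfact h (n - k) * fA k * fB k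
        / (fC k * fD k)
      = (-1) ^ n * rfact h n * fA 0 * fB 0 / (fC n * fD n)
          * symPoch h (C - A) n * symPoch h (C - B) n := by
  induction n with
  | zero => intro D fD _ _; simp [rfact_zero, symPoch_zero]
  | succ n ih =>
    intro D fD hD hs
    -- Lowering the order from `n + 1` to `n` preserves the balancing condition if `D` is raised by
    -- `h`; hence the quantification over `D` inside the induction.
    have ih' := ih (hD.shift 1 rfl) (by push_cast at hs ⊢; linear_combination hs)
    set P := sh (C - A + n * h) * sh (C - B + n * h) with hP
    set u : ℕ → ℂ := fun k => (-1) ^ k * rfact h k * rfact h ((n + 1 : ℕ) - k) * fA k * fB k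
        / (fC k * fD k) with hu
    set v : ℕ → ℂ := fun k => (-1) ^ k * rfact h k * rfact h (n - k) * fA k * fB k
        / (fC k * fD (1 + k)) with hv
    -- The certificate: up to bracket factors, the summand `u` of order `n + 1` and the summand `v`
    -- of order `n` differ by `G (k + 1) - G k`.
    set G : ℕ → ℂ := fun k => sh (k * h) * sh (C + k * h - h) * u k with hG
    have huv : ∀ k, v k * sh (D + k * h) = u k * sh (n * h + h - k * h) := by
      intro k
      have h1 := hD.succ k
      have h2 := rfact_pred hq ((n + 1 : ℕ) - k)
      have h3 := hD.ne k
      have h5 := hD.ne (1 + k)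
      have h4 := hC.ne k
      rw [show ((n + 1 : ℕ) : ℤ) - k - 1 = n - k by push_cast; ring,
        show (((n + 1 : ℕ) - k : ℤ) : ℂ) * h = n * h + h - k * h by push_cast; ring] at h2
      rw [add_comm] at h1
      simp only [hu, hv, h2]
      rw [h1] at h5 ⊢
      push_cast at h5 ⊢
      -- Each bracket to be cancelled is a factor of a value of a nonvanishing sequence, so no
      -- further genericity assumption is needed.
      have h6 := left_ne_zero_of_mul h5
      generalize sh (D + k * h) = t at h6 ⊢
      field_simp
    have hGs : ∀ k, G (k + 1) = -(sh (A + k * h) * sh (B + k * h) * v k) := by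
      intro k
      have h1 := hC.succ k
      have h2 := rfact_pred hq (k + 1 : ℕ)
      have h3 := hC.ne k
      have h4 := hC.ne (k + 1)
      have h5 := hD.ne (1 + k)
      have h6 := hA.succ k
      have h7 := hB.succ k
      rw [show ((k + 1 : ℕ) : ℤ) - 1 = k by push_cast; ring] at h2
      simp only [hG, hu, hv, h2]
      push_cast at h6 h7 h1 ⊢
      rw [h1] at h4
      rw [show (n : ℤ) + 1 - (k + 1) = n - k by ring, add_comm (1 : ℤ) k, h6, h7, h1]
      rw [add_comm] at h5
      have h8 := left_ne_zero_of_mul h4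
      rw [show C + ((k : ℂ) + 1) * h - h = C + k * h by ring]
      field_simp
      ring
    have key : ∀ k, -(sh (n * h + h) * sh (C + n * h)) * u k = P * v k + (G (k + 1) - G k) := by
      intro k
      have h5 := hD.ne (1 + k)
      have h1 := hD.succ k
      rw [add_comm] at h5
      rw [h1] at h5
      push_cast at h5
      have h6 := left_ne_zero_of_mul h5
      have id := saal_identity A B C (n * h) (k * h) h
      rw [show -(C - A - B + n * h - k * h) = D + k * h by
        push_cast at hs; linear_combination hs] at id
      apply mul_right_cancel₀ h6
      rw [hGs]
      simp only [hG]
      linear_combination u k * id - (P - sh (A + k * h) * sh (B + k * h)) * huv k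
    have hsum : -(sh (n * h + h) * sh (C + n * h)) * ∑ k ∈ Finset.range (n + 1 + 1), u k
        = P * ∑ k ∈ Finset.range (n + 1), v k := by
      rw [Finset.mul_sum, Finset.sum_congr rfl fun k _ => key k, Finset.sum_add_distrib,
        Finset.sum_range_sub, Finset.sum_range_succ, ← Finset.mul_sum]
      have e1 : v (n + 1) = 0 := by
        simp only [hv]; rw [rfact_neg (n := (n : ℤ) - (n + 1 : ℕ)) (by push_cast; omega)]; simp
      have e2 : G (n + 1 + 1) = 0 := by
        simp only [hG, hu]
        rw [rfact_neg (n := ((n + 1 : ℕ) : ℤ) - (n + 1 + 1 : ℕ)) (by push_cast; omega)]; simp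
      have e3 : G 0 = 0 := by simp [hG, sh_zero]
      rw [e1, e2, e3]; ring
    have h1 : sh (n * h + h) ≠ 0 := by
      have := hq (n + 1) (by omega)
      push_cast at this
      rwa [add_mul, one_mul] at this
    have h2 := hC.succ n
    have h3 := hC.ne (n + 1)
    have h4 := hC.ne n
    rw [h2] at h3
    push_cast at h3
    have h5 := left_ne_zero_of_mul h3
    have h6 := hD.ne (1 + n)
    change ∑ k ∈ Finset.range (n + 1 + 1), u k = _
    change ∑ k ∈ Finset.range (n + 1), v k = _ at ih'
    rw [ih', hP] at hsum
    apply mul_left_cancel₀ (neg_ne_zero.2 (mul_ne_zero h1 h5))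
    rw [hsum, symPoch_succ, symPoch_succ]
    have h7 := rfact_pred hq (n + 1 : ℕ)
    push_cast at h2 h7 ⊢
    rw [add_sub_cancel_right, add_mul, one_mul] at h7
    rw [h2, h7, add_comm (1 : ℤ) n] 
    rw [add_comm] at h6
    field_simp
    ring

end QRacah2
end

/-! ### The very-well-poised `6φ5` sum -/

noncomputable section

namespace QRacah2

variable {h : ℂ}

/-- The certificate for `vwp_zero` divided by the common factor `τ`, with `x` standing for `x h` and
`m` for `(M + 1) h`. -/
lemma vwp_identity (z b d x m : ℂ) :
    sh m * sh (b - z - m) * sh (d - z - m) * sh (z + 2 * x)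
        + sh (b + d - z - m) * (sh (z + 2 * x) * sh (m - x) * sh (z + x + m))
      = sh (m - x) * sh (z + x) * sh (b + x) * sh (d + x)
        + sh x * sh (z + x + m) * sh (b - z - x) * sh (d - z - x) := by
  simp only [sh, two_mul, Complex.exp_add, Complex.exp_sub, Complex.exp_neg, neg_add, neg_sub]
  field_simp
  ring

set_option maxHeartbeats 400000 in
/-- The terminating very-well-poised `6φ5` sum. -/
theorem vwp_zero (hq : ∀ k : ℕ, 1 ≤ k → sh (k * h) ≠ 0) {z b d : ℂ} {fz fb fd pb pd r : ℤ → ℂ}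
    (hz : IsGam h z fz) (hb : IsGam h b fb) (hd : IsGam h d fd) (hpb : IsGam h (b - z) pb)
    (hpd : IsGam h (d - z) pd) (hr : IsGam h (b + d - z) r) (M : ℕ) :
    ∑ x ∈ Finset.range (M + 1), (-1) ^ x * sh (z + 2 * (x * h)) * fz x / fz (x + M + 1)
        * rfact h x * rfact h (M - x) * fb x * pb (-x) * fd x * pd (-x)
      = (-1) ^ M * rfact h M * fb 0 * pb (-M) * fd 0 * pd (-M) * r 0 / r (-M) := by
  induction M with
  | zero =>
    have h1 := hz.succ 0
    have h2 := hz.ne (0 + 1)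
    have h3 := hz.ne 0
    have h4 := hr.ne 0
    rw [h1] at h2
    simp only [zero_add, Int.cast_zero, zero_mul, add_zero] at h1 h2
    have h5 := left_ne_zero_of_mul h2
    simp [rfact_zero, h1]
    field_simp
  | succ M ih =>
    set m : ℂ := M * h + h with hm
    -- The summand of order `M + 1` without its bracket `sh (z + 2 x h)`. The summand `v` of order
    -- `M` and both `G x` and `G (x + 1)` are products of brackets times `τ x`.
    set τ : ℕ → ℂ := fun x => (-1) ^ x * rfact h x * rfact h ((M + 1 : ℕ) - x) * fz x
      / fz (x + (M + 1 : ℕ) + 1) * fb x * pb (-x) * fd x * pd (-x) with hτ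
    set v : ℕ → ℂ := fun x => (-1) ^ x * sh (z + 2 * (x * h)) * fz x / fz (x + M + 1)
        * rfact h x * rfact h (M - x) * fb x * pb (-x) * fd x * pd (-x) with hv
    set G : ℕ → ℂ := fun x => (-1) ^ x * rfact h (x - 1) * rfact h ((M + 1 : ℕ) - x) * fz x
      / fz (x + M + 1) * fb x * pb (1 - x) * fd x * pd (1 - x) with hG
    have hfz : ∀ x : ℕ, fz (x + (M + 1 : ℕ) + 1) = sh (z + x * h + m) * fz (x + M + 1) := by
      intro x
      have := hz.succ (x + M + 1)
      push_cast at this ⊢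
      rw [← add_assoc, this, hm]; ring_nf
    have hfz0 : ∀ x : ℕ, sh (z + x * h + m) ≠ 0 := fun x =>
      left_ne_zero_of_mul ((hfz x) ▸ hz.ne _)
    have hQ : ∀ x : ℕ, rfact h (M - x) = sh (m - x * h) * rfact h ((M + 1 : ℕ) - x) := by
      intro x
      have := rfact_pred hq ((M + 1 : ℕ) - x)
      push_cast at this ⊢
      rw [show (M : ℤ) + 1 - x - 1 = M - x by ring] at this
      rw [this, hm]; ring_nf
    have hvτ : ∀ x, v x = sh (z + 2 * (x * h)) * sh (m - x * h) * sh (z + x * h + m) * τ x := by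
      intro x
      have h1 := hfz0 x
      simp only [hv, hτ, hfz, hQ, ← mul_div_mul_left _ (fz (x + M + 1)) h1]
      ring
    have hGτ : ∀ x, G x = sh (x * h) * sh (z + x * h + m) * sh (b - z - x * h)
        * sh (d - z - x * h) * τ x := by
      intro x
      have h1 := hfz0 x
      have h3 := hpb.succ (-x)
      have h4 := hpd.succ (-x)
      have h5 := rfact_pred hq x
      push_cast at h3 h4 h5
      rw [show -(x : ℤ) + 1 = 1 - x by ring, neg_mul, ← sub_eq_add_neg] at h3 h4
      simp only [hG, hτ, hfz, h3, h4, h5, ← mul_div_mul_left _ (fz (x + M + 1)) h1]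
      ring
    have hGs : ∀ x, G (x + 1) = -(sh (m - x * h) * sh (z + x * h) * sh (b + x * h)
        * sh (d + x * h) * τ x) := by
      intro x
      have h3 := hz.succ x
      have h4 := hb.succ x
      have h5 := hd.succ x
      have h7 := hQ x
      push_cast at h3 h4 h5 h7
      simp only [hG, hτ]
      push_cast
      rw [show (M : ℤ) + 1 - (x + 1) = M - x by ring, show (1 : ℤ) - (x + 1) = -x by ring,
        show (x : ℤ) + (M + 1) + 1 = x + 1 + M + 1 by ring, show (x : ℤ) + 1 - 1 = x by ring, h7,
        h3, h4, h5]
      ring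
    have key : ∀ x : ℕ, sh m * sh (b - z - m) * sh (d - z - m) * (sh (z + 2 * (x * h)) * τ x)
        = -sh (b + d - z - m) * v x + (G x - G (x + 1)) := by
      intro x
      rw [hvτ, hGs, hGτ]
      linear_combination τ x * vwp_identity z b d (x * h) m
    have hsum : sh m * sh (b - z - m) * sh (d - z - m)
          * ∑ x ∈ Finset.range (M + 1 + 1), sh (z + 2 * (x * h)) * τ x
        = -sh (b + d - z - m) * ∑ x ∈ Finset.range (M + 1), v x := by
      rw [Finset.mul_sum, Finset.sum_congr rfl fun k _ => key k, Finset.sum_add_distrib,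
        Finset.sum_range_sub', Finset.sum_range_succ, ← Finset.mul_sum]
      have e1 : v (M + 1) = 0 := by
        simp only [hv]; rw [rfact_neg (n := (M : ℤ) - (M + 1 : ℕ)) (by push_cast; omega)]; simp
      have e2 : G (M + 1 + 1) = 0 := by
        simp only [hG]
        rw [rfact_neg (n := ((M + 1 : ℕ) : ℤ) - (M + 1 + 1 : ℕ)) (by push_cast; omega)]; simp
      have e3 : G 0 = 0 := by simp [hG, rfact_neg]
      rw [e1, e2, e3]; ring
    have hpm : ∀ {w : ℂ} {p : ℤ → ℂ}, IsGam h w p →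
        p (-M) = sh (w - m) * p (-(M + 1 : ℕ)) := by
      intro w p hp
      have := hp.succ (-(M + 1 : ℕ))
      rw [show -((M + 1 : ℕ) : ℤ) + 1 = -M by push_cast; ring] at this
      rw [this, hm]; push_cast; ring_nf
    have h1 : sh m ≠ 0 := by
      have := hq (M + 1) (by omega)
      push_cast at this
      rwa [add_mul, one_mul] at this
    have hb1 := hpm hpb
    have hd1 := hpm hpd
    have hr1 := hpm hr
    have hb2 := left_ne_zero_of_mul (hb1 ▸ hpb.ne (-M))
    have hd2 := left_ne_zero_of_mul (hd1 ▸ hpd.ne (-M))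
    have hr2 := left_ne_zero_of_mul (hr1 ▸ hr.ne (-M))
    have hr3 := hr.ne (-(M + 1 : ℕ))
    change ∑ x ∈ Finset.range (M + 1), v x = _ at ih
    rw [ih, hb1, hd1, hr1] at hsum
    have h7 := rfact_pred hq (M + 1 : ℕ)
    rw [show ((M + 1 : ℕ) : ℤ) - 1 = M by push_cast; ring,
      show (((M + 1 : ℕ) : ℤ) : ℂ) * h = m by push_cast; rw [hm]; ring] at h7
    rw [h7] at hsum
    apply mul_left_cancel₀ (mul_ne_zero (mul_ne_zero h1 hb2) hd2)
    refine Eq.trans ?_ (hsum.trans ?_)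
    · congr 1
      refine Finset.sum_congr rfl fun x _ => ?_
      simp only [hτ]; ring
    · rw [mul_div_assoc', mul_div_assoc', div_eq_div_iff (mul_ne_zero hr2 hr3) hr3]
      ring

/-- The terminating very-well-poised `6φ5` sum, over a shifted range. -/
theorem vwp (hq : ∀ k : ℕ, 1 ≤ k → sh (k * h) ≠ 0) {z b d : ℂ} {fz fb fd pb pd r : ℤ → ℂ}
    (hz : IsGam h z fz) (hb : IsGam h b fb) (hd : IsGam h d fd) (hpb : IsGam h (b - z) pb)
    (hpd : IsGam h (d - z) pd) (hr : IsGam h (b + d - z) r) (k K : ℕ) :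
    ∑ x ∈ Finset.range (K + 1), (-1) ^ x * sh (z + 2 * (x * h)) * fz (x + k) / fz (x + K + 1)
        * rfact h (x - k) * rfact h (K - x) * fb x * pb (-x) * fd x * pd (-x)
      = (-1) ^ K * rfact h (K - k) * fb k * pb (-K) * fd k * pd (-K) * r 0 / r (k - K) := by
  rcases lt_or_ge K k with hk | hk
  · rw [rfact_neg (n := (K : ℤ) - k) (by omega)]
    simp only [mul_zero, zero_mul, zero_div]
    refine Finset.sum_eq_zero fun x hx => ?_
    have := Finset.mem_range.1 hx
    rw [rfact_neg (n := (x : ℤ) - k) (by omega)]; ring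
  · rw [sum_range_shift _ K k hk fun i hi => by
      rw [rfact_neg (n := (i : ℤ) - k) (by omega)]; ring]
    obtain ⟨M, rfl⟩ := Nat.exists_eq_add_of_le hk
    -- Starting the sum at `x = k` replaces `z, b, d` by `z + 2kh, b + kh, d + kh`. Then `b - z` and
    -- `d - z` drop by `kh`, and `b + d - z` is unchanged.
    have hz' : IsGam h (z + 2 * (k * h)) fun x => fz (2 * k + x) :=
      hz.shift (2 * k) (by push_cast; ring)
    have hb' : IsGam h (b + k * h) fun x => fb (k + x) := hb.shift k (by push_cast; ring)
    have hd' : IsGam h (d + k * h) fun x => fd (k + x) := hd.shift k (by push_cast; ring)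
    have hpb' : IsGam h (b + k * h - (z + 2 * (k * h))) fun x => pb (-k + x) :=
      hpb.shift (-k) (by push_cast; ring)
    have hpd' : IsGam h (d + k * h - (z + 2 * (k * h))) fun x => pd (-k + x) :=
      hpd.shift (-k) (by push_cast; ring)
    have hr' : IsGam h (b + k * h + (d + k * h) - (z + 2 * (k * h))) r := by
      convert hr using 1; ring
    have := vwp_zero hq hz' hb' hd' hpb' hpd' hr' M
    rw [show k + M - k + 1 = M + 1 by omega]
    have e : ∀ x : ℕ, -(k : ℤ) + -x = -(k + x : ℕ) := by intro x; push_cast; ring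
    simp only [e, add_zero] at this
    rw [show ((k + M : ℕ) : ℤ) - k = M by push_cast; ring,
      show (k : ℤ) - (k + M : ℕ) = -M by push_cast; ring, pow_add]
    calc _ = (-1) ^ k * ∑ x ∈ Finset.range (M + 1), _ := ?_
      _ = _ := congrArg _ this
      _ = _ := by ring
    rw [Finset.mul_sum]
    refine Finset.sum_congr rfl fun x _ => ?_
    push_cast
    rw [pow_add, show (k : ℤ) + x + k = 2 * k + x by ring,
      show (k : ℤ) + x + (k + M) + 1 = 2 * k + (x + M + 1) by ring,
      show (k : ℤ) + x - k = x by ring, show (k : ℤ) + M - (k + x) = M - x by ring,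
      show z + 2 * (k * h) + 2 * (x * h) = z + 2 * ((k + x) * h) by ring]
    ring

/-! ### Sears' transformation -/

/-- The `q`-Saalschütz sum in the form of a connection formula. -/
lemma saal_connection (hq : ∀ k : ℕ, 1 ≤ k → sh (k * h) ≠ 0) {B C D : ℂ}
    {fB fC fD gB gC fG : ℤ → ℂ} (hB : IsGam h B fB) (hC : IsGam h C fC) (hD : IsGam h D fD)
    (hgB : IsGam h (D - B) gB) (hgC : IsGam h (D - C) gC) (hG : IsGam h (B + C - D) fG) (i : ℕ) :
    rfact h i * fB i * fC i / fD i = fB 0 * fC 0 / (gB 0 * gC 0 * fG 0)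
      * ∑ j ∈ Finset.range (i + 1), rfact h j * rfact h (i - j) * gB j * gC j * fG (i - j)
        / fD j := by
  -- Saalschütz is read from right to left: `D - B` and `D - C` are its numerator parameters, and
  -- balancing forces the second denominator to be the reflection of `B + C - D`.
  have this := saal hq hgB hgC hD i (D := -(B + C - D) + (1 - i) * h)
    (hG.neg i (by push_cast; ring)) (by ring)
  rw [sub_sub_cancel, sub_sub_cancel, hB.symPoch_eq, hC.symPoch_eq] at this
  have e : ∑ j ∈ Finset.range (i + 1), rfact h j * rfact h (i - j) * gB j * gC j * fG (i - j)
      / fD j = ∑ k ∈ Finset.range (i + 1), (-1) ^ k * rfact h k * rfact h (i - k) * gB k * gC k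
        / (fD k * ((-1) ^ (k : ℤ) / fG (i - k))) := by
    refine Finset.sum_congr rfl fun k _ => ?_
    have h1 := hD.ne k
    have h2 := hG.ne (i - k)
    rw [zpow_natCast]
    field_simp
  have hgB0 := hgB.ne 0
  have hgC0 := hgC.ne 0
  have hG0 := hG.ne 0
  have hB0 := hB.ne 0
  have hC0 := hC.ne 0
  have hDi := hD.ne i
  rw [e, this, zpow_natCast, sub_self]
  clear this e
  field_simp

/-- The inner sum after the interchange in `sears`. Only `i ≥ j` contributes, and with `i = j + t`
the remaining sum over `t` is a balanced Saalschütz sum. -/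
lemma sears_inner (hq : ∀ k : ℕ, 1 ≤ k → sh (k * h) ≠ 0) (j m : ℕ) {A B C D E F : ℂ}
    {fA fE fF kE kF fG : ℤ → ℂ} (hA : IsGam h A fA) (hE : IsGam h E fE) (hF : IsGam h F fF)
    (hs : A + B + C + h - (j + m : ℕ) * h = D + E + F)
    (hkE : IsGam h (A - E + (1 - (j + m : ℕ)) * h) kE)
    (hkF : IsGam h (A - F + (1 - (j + m : ℕ)) * h) kF) (hG : IsGam h (B + C - D) fG) :
    ∑ i ∈ Finset.range (j + m + 1),
      (-1) ^ i * rfact h ((j + m : ℕ) - i) * rfact h (i - j) * fA i * fG (i - j) / (fE i * fF i)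
      = (-1) ^ j * rfact h m * fA j * fG 0 * kE (j + m : ℕ) * kF (j + m : ℕ)
        / (fE (j + m : ℕ) * fF (j + m : ℕ) * kE j * kF j) := by
  rw [sum_range_shift _ (j + m) j (by omega) fun i hi => by
    rw [rfact_neg (n := (i : ℤ) - j) (by omega)]; ring]
  have this := saal hq (hA.shift j (w := A + j * h) (by push_cast; ring)) hG
    (hE.shift j (w := E + j * h) (by push_cast; ring)) m (hF.shift j (w := F + j * h)
      (by push_cast; ring)) (by push_cast at hs; linear_combination hs)
  rw [hkE.symPoch_neg (j + m) m (by push_cast; ring),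
    hkF.symPoch_shift j m (by push_cast at hs ⊢; linear_combination -hs)] at this
  simp only [add_zero, add_sub_cancel_right] at this
  rw [show j + m - j + 1 = m + 1 by omega]
  calc _ = (-1) ^ j * ∑ x ∈ Finset.range (m + 1), _ := ?_
    _ = _ := congrArg _ this
    _ = _ := ?_
  · rw [Finset.mul_sum]
    refine Finset.sum_congr rfl fun x _ => ?_
    push_cast
    rw [show (j : ℤ) + m - (j + x) = m - x by ring, show (j : ℤ) + x - j = x by ring]
    ring
  · have e : ((-1 : ℂ) ^ m) * (-1) ^ m = 1 := by rw [← mul_pow]; simp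
    push_cast
    simp only [div_eq_mul_inv, mul_inv]
    linear_combination ((-1) ^ j * rfact h m * fA j * fG 0 * kE (j + m) * kF (j + m)
      * (fE (j + m))⁻¹ * (fF (j + m))⁻¹ * (kE j)⁻¹ * (kF j)⁻¹) * e

/-- Sears' transformation of terminating balanced `4φ3` series. -/
theorem sears (hq : ∀ k : ℕ, 1 ≤ k → sh (k * h) ≠ 0) (n : ℕ) {A B C D E F : ℂ}
    {fA fB fC fD fE fF gB gC kE kF fG : ℤ → ℂ}
    (hA : IsGam h A fA) (hB : IsGam h B fB) (hC : IsGam h C fC) (hD : IsGam h D fD)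
    (hE : IsGam h E fE) (hF : IsGam h F fF) (hs : A + B + C + h - n * h = D + E + F)
    (hgB : IsGam h (D - B) gB) (hgC : IsGam h (D - C) gC) (hkE : IsGam h (A - E + (1 - n) * h) kE)
    (hkF : IsGam h (A - F + (1 - n) * h) kF) (hG : IsGam h (B + C - D) fG) :
    ∑ i ∈ Finset.range (n + 1), (-1) ^ i * rfact h i * rfact h (n - i) * fA i * fB i * fC i
        / (fD i * fE i * fF i)
      = fB 0 * fC 0 * kE n * kF n / (fE n * fF n * gB 0 * gC 0)
        * ∑ j ∈ Finset.range (n + 1), (-1) ^ j * rfact h j * rfact h (n - j) * fA j * gB j * gC j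
            / (fD j * kE j * kF j) := by
  calc _ = ∑ i ∈ Finset.range (n + 1), (-1) ^ i * rfact h (n - i) * fA i / (fE i * fF i)
        * (rfact h i * fB i * fC i / fD i) := Finset.sum_congr rfl fun i _ => by
          rw [div_mul_div_comm]; congr 1 <;> ring
    _ = ∑ i ∈ Finset.range (n + 1), ∑ j ∈ Finset.range (n + 1),
          fB 0 * fC 0 / (gB 0 * gC 0 * fG 0) * (rfact h j * gB j * gC j / fD j) *
          ((-1) ^ i * rfact h (n - i) * rfact h (i - j) * fA i * fG (i - j) / (fE i * fF i)) := by
        refine Finset.sum_congr rfl fun i hi => ?_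
        have hi := Finset.mem_range.1 hi
        rw [saal_connection hq hB hC hD hgB hgC hG, Finset.mul_sum, Finset.mul_sum]
        -- The triangle `j ≤ i` is filled up to a square at no cost, since `rfact h (i - j)`
        -- vanishes for `j > i`; this permits the interchange.
        refine Finset.sum_subset_zero_on_sdiff (Finset.range_mono (by omega)) (fun j hj => ?_)
          fun j _ => by ring
        simp only [Finset.mem_sdiff, Finset.mem_range] at hj
        rw [rfact_neg (n := (i : ℤ) - j) (by omega)]; ring
    _ = _ := by
        rw [Finset.sum_comm, Finset.mul_sum]
        refine Finset.sum_congr rfl fun j hj => ?_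
        have hj := Finset.mem_range.1 hj
        obtain ⟨m, rfl⟩ := Nat.exists_eq_add_of_le (show j ≤ n by omega)
        rw [← Finset.mul_sum, sears_inner hq j m hA hE hF hs hkE hkF hG]
        have hG0 := hG.ne 0
        rw [show ((j + m : ℕ) : ℤ) - j = m by push_cast; ring]
        simp only [div_eq_mul_inv, mul_inv]
        linear_combination (fB 0 * fC 0 * (gB 0)⁻¹ * (gC 0)⁻¹ * rfact h j * gB j * gC j * (fD j)⁻¹
          * (-1) ^ j * rfact h m * fA j * kE (j + m : ℕ) * kF (j + m : ℕ) * (fE (j + m : ℕ))⁻¹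
          * (fF (j + m : ℕ))⁻¹ * (kE j)⁻¹ * (kF j)⁻¹) * mul_inv_cancel₀ hG0

end QRacah2
end

/-! ### Gamma sequences for the parameters, and the one-variable sums -/

noncomputable section

namespace QRacah2

/-- Symmetric gamma sequences for the bases built from the parameters
`h, a, g, p, c` (logarithms of the square roots of `q, α, γ, γ', c`). -/
structure GamData (h a g p c : ℂ) where
  /-- base `a` -/
  Ea : ℤ → ℂ
  /-- base `g` -/
  Eg : ℤ → ℂ
  /-- base `p` -/
  Ep : ℤ → ℂ
  /-- base `c` -/
  Ec : ℤ → ℂ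
  /-- base `p - c` -/
  Ee : ℤ → ℂ
  /-- base `a + c - p` -/
  Ed : ℤ → ℂ
  /-- base `g + p - a - c` -/
  EA : ℤ → ℂ
  /-- base `g + p - a` -/
  EB : ℤ → ℂ
  /-- base `a - p` -/
  Et : ℤ → ℂ
  /-- base `g + 2 p - 2 a - c` -/
  Er : ℤ → ℂ
  /-- base `c - a` -/
  Es : ℤ → ℂ
  hq : ∀ k : ℕ, 1 ≤ k → sh (k * h) ≠ 0
  ha : IsGam h a Ea
  hg : IsGam h g Eg
  hp : IsGam h p Ep
  hc : IsGam h c Ec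
  he : IsGam h (p - c) Ee
  hd : IsGam h (a + c - p) Ed
  hA : IsGam h (g + p - a - c) EA
  hB : IsGam h (g + p - a) EB
  ht : IsGam h (a - p) Et
  hr : IsGam h (g + 2 * p - 2 * a - c) Er
  hs : IsGam h (c - a) Es
  hg0 : Eg 0 = 1
  hp0 : Ep 0 = 1
  he0 : Ee 0 = 1
  hA0 : EA 0 = 1
  hB0 : EB 0 = 1

lemma symPoch_neg_nat {h : ℂ} (hq : ∀ k : ℕ, 1 ≤ k → sh (k * h) ≠ 0) (k m : ℕ) :
    symPoch h (-(k * h)) m = (-1) ^ m * rfact h (k - m) / rfact h k := by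
  have h0 : rfact h k ≠ 0 := rfact_ne hq (by omega)
  induction m with
  | zero => simp [symPoch_zero, h0]
  | succ m ih =>
    have h1 := rfact_pred hq (k - m)
    rw [symPoch_succ, ih, show (k : ℤ) - (m + 1 : ℕ) = k - m - 1 by push_cast; ring, h1,
      show -(k * h) + m * h = -(((k - m : ℤ) : ℂ) * h) by push_cast; ring, sh_neg]
    ring

lemma sum_range_extend (f : ℕ → ℂ) (K N : ℕ) (hK : K ≤ N) (hf : ∀ i, K < i → f i = 0) :
    ∑ i ∈ Finset.range (N + 1), f i = ∑ i ∈ Finset.range (K + 1), f i := by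
  symm
  refine Finset.sum_subset (Finset.range_mono (by omega)) fun i _ hi => hf i ?_
  simp at hi; omega

namespace GamData

variable {h a g p c : ℂ} (E : GamData h a g p c)

local notation "Q" => rfact h

/-- The factor `Q (N - x - y)` stops the sum at `K = N - y`. What remains is `vwp` with `z = g + p -
a - c - (N + 1) h`, `b = g + i h`, `d = -c + (r - y) h`, so that `b - z`, `d - z`, `b + d - z` have
bases `a + c - p`, `-(g + p - a)`, `a - p` up to multiples of `h`. -/
lemma sum_x (N k i y : ℕ) (r : ℤ) (hy : y ≤ N) :
    ∑ x ∈ Finset.range (N + 1), (-1) ^ x * sh (g + p - a - c + (2 * x - N - 1) * h)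
        * E.EA (x - N - 1 + k) / E.EA (x - y) * Q (x - k) * Q (N - x - y) * E.Eg (x + i)
        * E.Ed (N + 1 - x + i) / (E.Ec (1 + y - x - r) * E.EB (x + y - N - r))
      = (-1) ^ k * Q (N - y - k) * E.Eg (k + i) * E.Ed (1 + y + i) * E.Et (1 + N + i - y + r)
        / (E.Ec (1 + y - k - r) * E.EB (-r) * E.Et (1 + i + r + k)) := by
  obtain ⟨K, rfl⟩ := Nat.exists_eq_add_of_le hy
  rw [sum_range_extend _ K _ (by omega) fun x hx => by
    rw [rfact_neg (n := ((y + K : ℕ) : ℤ) - x - y) (by push_cast; omega)]; ring]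
  have H := vwp E.hq (z := g + p - a - c - (y + K + 1) * h) (b := g + i * h)
    (d := -c + (r - y) * h)
    (E.hA.shift (-y - K - 1) (by push_cast; ring)) (E.hg.shift i (by push_cast; ring))
    (E.hc.neg (1 + y - r) (by push_cast; ring))
    (E.hd.shift (y + K + 1 + i) (by push_cast; ring))
    (E.hB.neg (-K - r) (by push_cast; ring)) (E.ht.shift (i + r + K + 1) (by push_cast; ring)) k K
  simp only [← zpow_natCast (-1 : ℂ)] at H ⊢
  have e1 : ∀ j : ℤ, (-1 : ℂ) ^ (-j) = (-1) ^ j := fun j => by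
    rw [zpow_neg, ← inv_zpow]; norm_num
  have e2 : ∀ j : ℤ, (-1 : ℂ) ^ j * (-1) ^ j = 1 := fun j => by
    rw [← mul_zpow]; norm_num
  refine Eq.trans (Finset.sum_congr rfl fun x _ => ?_) (H.trans ?_)
  · simp only [e1]
    push_cast
    rw [show -(y : ℤ) - K - 1 + (x + k) = x - (y + K) - 1 + k by ring,
      show -(y : ℤ) - K - 1 + (x + K + 1) = x - y by ring, show (i : ℤ) + x = x + i by ring,
      show (y : ℤ) + K + 1 + i + -x = y + K + 1 - x + i by ring,
      show 1 + (y : ℤ) - r - x = 1 + y - x - r by ring,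
      show -(K : ℤ) - r - -x = x + y - (y + K) - r by ring,
      show (y : ℤ) + K - x - y = K - x by ring,
      show g + p - a - c - (y + K + 1) * h + 2 * (x * h)
        = g + p - a - c + (2 * x - (y + K) - 1) * h by ring]
    simp only [div_eq_mul_inv, mul_inv]
    linear_combination (-((-1) ^ (x : ℤ)
      * sh (g + p - a - c + (2 * x - (y + K) - 1) * h) * E.EA (x - (y + K) - 1 + k)
      * (E.EA (x - y))⁻¹ * Q (x - k) * Q (K - x) * E.Eg (x + i) * E.Ed (y + K + 1 - x + i)
      * (E.Ec (1 + y - x - r))⁻¹ * (E.EB (x + y - (y + K) - r))⁻¹)) * e2 x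
  · simp only [e1]
    push_cast
    rw [show (i : ℤ) + k = k + i by ring, show (y : ℤ) + K + 1 + i + -K = 1 + y + i by ring,
      show 1 + (y : ℤ) - r - k = 1 + y - k - r by ring,
      show -(K : ℤ) - r - -K = -r by ring, show (y : ℤ) + K - y - k = K - k by ring,
      show (i : ℤ) + r + K + 1 + 0 = 1 + (y + K) + i - y + r by ring,
      show (i : ℤ) + r + K + 1 + (k - K) = 1 + i + r + k by ring]
    simp only [div_eq_mul_inv, mul_inv]
    linear_combination ((-1) ^ (k : ℤ) * Q (K - k) * E.Eg (k + i) * E.Ed (1 + y + i)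
      * E.Et (1 + (y + K) + i - y + r) * (E.Ec (1 + y - k - r))⁻¹ * (E.EB (-r))⁻¹
      * (E.Et (1 + i + r + k))⁻¹) * e2 K

/-- This is `vwp` with `z = c - N h`, `b = p + j h`, `d = a + c - p + (1 + m) h`, truncated at `N -
k`; now `b + d - z` has base `a`, which is how the sequence `Ea` enters the moments. -/
lemma sum_y (N k l m j : ℕ) (hk : k ≤ N) :
    ∑ y ∈ Finset.range (N + 1), (-1) ^ y * sh (c + (2 * y - N) * h) * Q (y - l) * Q (N - y - k)
        * E.Ec (y - N + l) / E.Ec (1 + y - k) * E.Ep (y + j) * E.Ee (N - y + j)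
        * E.Ed (1 + y + m) * E.Et (1 - y + N + m)
      = (-1) ^ (N - k) * Q (N - k - l) * E.Ep (l + j) * E.Ee (k + j) * E.Ed (1 + l + m)
        * E.Et (1 + k + m) * E.Ea (N + m + 1 + j) / E.Ea (m + 1 + k + l + j) := by
  obtain ⟨K, rfl⟩ := Nat.exists_eq_add_of_le hk
  rw [sum_range_extend _ K _ (by omega) fun x hx => by
    rw [rfact_neg (n := ((k + K : ℕ) : ℤ) - x - k) (by push_cast; omega)]; ring]
  have H := vwp E.hq (z := c - (k + K) * h) (b := p + j * h) (d := a + c - p + (1 + m) * h)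
    (E.hc.shift (-k - K) (by push_cast; ring)) (E.hp.shift j (by push_cast; ring))
    (E.hd.shift (1 + m) (by push_cast; ring))
    (E.he.shift (k + K + j) (by push_cast; ring))
    (E.ht.shift (1 + k + K + m) (by push_cast; ring))
    (E.ha.shift (k + K + m + 1 + j) (by push_cast; ring)) l K
  refine Eq.trans (Finset.sum_congr rfl fun x _ => ?_) (H.trans ?_)
  · push_cast
    rw [show -(k : ℤ) - K + (x + l) = x - (k + K) + l by ring,
      show -(k : ℤ) - K + (x + K + 1) = 1 + x - k by ring, show (j : ℤ) + x = x + j by ring,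
      show (k : ℤ) + K + j + -x = k + K - x + j by ring,
      show 1 + (m : ℤ) + x = 1 + x + m by ring,
      show 1 + (k : ℤ) + K + m + -x = 1 - x + (k + K) + m by ring,
      show (k : ℤ) + K - x - k = K - x by ring,
      show c - (k + K) * h + 2 * (x * h) = c + (2 * x - (k + K)) * h by ring]
    ring
  · rw [show k + K - k = K by omega]
    push_cast
    rw [show (j : ℤ) + l = l + j by ring, show (k : ℤ) + K + j + -K = k + j by ring,
      show 1 + (m : ℤ) + l = 1 + l + m by ring,
      show 1 + (k : ℤ) + K + m + -K = 1 + k + m by ring,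
      show (k : ℤ) + K - k - l = K - l by ring,
      show (k : ℤ) + K + m + 1 + j + 0 = k + K + m + 1 + j by ring,
      show (k : ℤ) + K + m + 1 + j + (l - K) = m + 1 + k + l + j by ring]

/-- Saalschütz with a numerator and a denominator parameter differing by `k h`. The product of base
`-k h` yields `Q (k - m)`, the source of the vanishing of the moments for `k < m`. -/
lemma sum_i (k m n : ℕ) (j : ℤ) :
    ∑ i ∈ Finset.range (m + 1), (-1) ^ i * Q i * Q (m - i) * E.Eg (k + i) * E.Et (m + n - j + i)
        / (E.Eg i * E.Et (1 + n - j + k + i))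
      = Q m * Q (k - m) / Q k * E.Eg k * E.Et (m + n - j) * E.EB (j - n)
        / (E.Eg m * E.Et (1 + k + m + n - j) * E.EB (j - (m + n))) := by
  have H := saal E.hq (E.hg.shift k (w := g + k * h) (by push_cast; ring))
    (E.ht.shift (m + n - j) (w := a - p + (m + n - j) * h) (by push_cast; ring)) E.hg m
    (E.ht.shift (1 + n - j + k) (w := a - p + (1 + n - j + k) * h) (by push_cast; ring)) (by ring)
  rw [show g - (g + k * h) = -(k * h) by ring, symPoch_neg_nat E.hq,
    E.hB.symPoch_shift (j - (m + n)) m (by push_cast; ring)] at H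
  rw [H]
  have e2 : (-1 : ℂ) ^ m * (-1) ^ m = 1 := by rw [← mul_pow]; norm_num
  rw [add_zero, add_zero, show 1 + (n : ℤ) - j + k + m = 1 + k + m + n - j by ring,
    show j - ((m : ℤ) + n) + m = j - n by ring]
  simp only [div_eq_mul_inv, mul_inv]
  linear_combination (Q m * Q (k - m) * (Q k)⁻¹ * E.Eg k * E.Et (m + n - j) * E.EB (j - n)
    * (E.Eg m)⁻¹ * (E.Et (1 + k + m + n - j))⁻¹ * (E.EB (j - (m + n)))⁻¹) * e2

lemma sum_j (k l m n : ℕ) :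
    ∑ j ∈ Finset.range (n + 1), (-1) ^ j * Q j * Q (n - j) * E.Ep (l + j) * E.Ea (k + m + n + j)
        / (E.Ep j * E.Ea (m + 1 + k + l + j))
      = (-1) ^ n * Q n * Q (l - n) / Q l * E.Ep l * E.Ea (k + m + n) * E.Et (1 + k + m + n)
        / (E.Ep n * E.Ea (m + 1 + k + l + n) * E.Et (1 + k + m)) := by
  have H := saal E.hq (E.hp.shift l (w := p + l * h) (by push_cast; ring))
    (E.ha.shift (k + m + n) (w := a + (k + m + n) * h) (by push_cast; ring)) E.hp n
    (E.ha.shift (m + 1 + k + l) (w := a + (m + 1 + k + l) * h) (by push_cast; ring)) (by ring)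
  rw [show p - (p + l * h) = -(l * h) by ring, symPoch_neg_nat E.hq,
    E.ht.symPoch_neg (1 + k + m + n) n (by push_cast; ring)] at H
  rw [H]
  have e2 : (-1 : ℂ) ^ n * (-1) ^ n = 1 := by rw [← mul_pow]; norm_num
  rw [add_zero, add_zero, show 1 + (k : ℤ) + m + n - n = 1 + k + m by ring]
  simp only [div_eq_mul_inv, mul_inv]
  linear_combination ((-1) ^ n * Q n * Q (l - n) * (Q l)⁻¹ * E.Ep l * E.Ea (k + m + n)
    * E.Et (1 + k + m + n) * (E.Ep n)⁻¹ * (E.Ea (m + 1 + k + l + n))⁻¹ * (E.Et (1 + k + m))⁻¹) * e2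

/-- The purpose is to collect the `x`-dependence: inside the transformed sum, `x` occurs only in `Eg
(x + i)` and `Ed (N + 1 - x + i)`, which fit the `6φ5` sum `sum_x`. The base `g + 2p - 2a - c` is
only the auxiliary `B + C - D` of `sears`. -/
lemma sears_i (N x y m n : ℕ) (j : ℤ) :
    ∑ i ∈ Finset.range (m + 1), (-1) ^ i * Q i * Q (m - i) * E.Eg (x + i) * E.EA (x - N - 1 + i)
        * E.EB (j - (m + n) + i)
        / (E.Eg i * E.EA (x - y - m + i) * E.EB (x + y - N - (m + n) + j + i))
      = E.EA (x - N - 1) * E.EB (j - (m + n)) * E.Ed (1 + y + m) * E.Et (1 + N - y + m + n - j)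
        / (E.EA (x - y) * E.EB (x + y - N - n + j) * E.Ed (N + 1 - x) * E.Et (m + n - j))
        * ∑ i ∈ Finset.range (m + 1), (-1) ^ i * Q i * Q (m - i) * E.Eg (x + i)
          * E.Ed (N + 1 - x + i) * E.Et (m + n - j + i)
          / (E.Eg i * E.Ed (1 + y + i) * E.Et (1 + N - y + n - j + i)) := by
  have H := sears E.hq m (E.hg.shift x (w := g + x * h) (by push_cast; ring))
    (E.hA.shift (x - N - 1) (w := g + p - a - c + (x - N - 1) * h) (by push_cast; ring))
    (E.hB.shift (j - (m + n)) (w := g + p - a + (j - (m + n)) * h) (by push_cast; ring)) E.hg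
    (E.hA.shift (x - y - m) (w := g + p - a - c + (x - y - m) * h) (by push_cast; ring))
    (E.hB.shift (x + y - N - (m + n) + j) (w := g + p - a + (x + y - N - (m + n) + j) * h)
      (by push_cast; ring)) (by ring)
    (E.hd.shift (N + 1 - x) (by push_cast; ring)) (E.ht.shift (m + n - j) (by push_cast; ring))
    (E.hd.shift (1 + y) (by push_cast; ring))
    (E.ht.shift (1 + N - y + n - j) (by push_cast; ring))
    (E.hr.shift (x - N - 1 + j - (m + n)) (by push_cast; ring))
  rw [H]
  simp only [add_zero]
  rw [show (x : ℤ) - y - m + m = x - y by ring,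
    show (x : ℤ) + y - N - (m + n) + j + m = x + y - N - n + j by ring,
    show 1 + (N : ℤ) - y + n - j + m = 1 + N - y + m + n - j by ring]

/-- The counterpart of `sears_i` for the sum left after `x` and `i` are gone; the transformed
summand fits `sum_y`. The reflected sequences `Et` supply two parameters, and `c - a` is the
auxiliary base. -/
lemma sears_j (N k y m n : ℕ) :
    ∑ j ∈ Finset.range (n + 1), (-1) ^ j * Q j * Q (n - j) * E.Ep (y + j) * E.Ec (y - N + j)
        * E.Et (1 + N - y + m + n - j)
        / (E.Ep j * E.Et (1 + k + m + n - j) * E.Ec (1 + y - k - n + j))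
      = (-1) ^ n * E.Ec (y - N) * E.Et (1 + N - y + m) * E.Ee (k + n) * E.Ea (N + m + 1 + n)
        / (E.Et (1 + k + m + n) * E.Ec (1 + y - k) * E.Ea (k + m + n) * E.Ee (N - y))
        * ∑ j ∈ Finset.range (n + 1), (-1) ^ j * Q j * Q (n - j) * E.Ep (y + j)
          * E.Ee (N - y + j) * E.Ea (k + m + n + j)
          / (E.Ep j * E.Ee (k + j) * E.Ea (N + m + 1 + j)) := by
  have H := sears E.hq n (E.hp.shift y (w := p + y * h) (by push_cast; ring))
    (E.hc.shift (y - N) (w := c + (y - N) * h) (by push_cast; ring))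
    (E.ht.neg (1 + k + m + n) (w := -(a - p) - (k + m + n) * h) (by push_cast; ring)) E.hp
    (E.hc.shift (1 + y - k - n) (w := c + (1 + y - k - n) * h) (by push_cast; ring))
    (E.ht.neg (1 + N - y + m + n) (w := -(a - p) - (N - y + m + n) * h) (by push_cast; ring))
    (by ring)
    (E.he.shift (N - y) (by push_cast; ring)) (E.ha.shift (k + m + n) (by push_cast; ring))
    (E.he.shift k (by push_cast; ring)) (E.ha.shift (N + m + 1) (by push_cast; ring))
    (E.hs.shift (y - N - (k + m + n)) (by push_cast; ring))
  refine Eq.trans (Finset.sum_congr rfl fun x _ => ?_) (H.trans ?_)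
  · have e2 : (-1 : ℂ) ^ (x : ℤ) ≠ 0 := zpow_ne_zero _ (by norm_num)
    have h1 := E.ht.ne (1 + N - y + m + n - x)
    generalize (-1 : ℂ) ^ (x : ℤ) = s at *
    simp only [div_eq_mul_inv, mul_inv, inv_inv]
    linear_combination (-((-1) ^ x * Q x * Q (n - x) * E.Ep (y + x) * E.Ec (y - N + x)
      * E.Et (1 + N - y + m + n - x) * (E.Ep x)⁻¹ * (E.Et (1 + k + m + n - x))⁻¹
      * (E.Ec (1 + y - k - n + x))⁻¹)) * mul_inv_cancel₀ e2
  · congr 1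
    simp only [add_zero, sub_zero, zpow_zero, zpow_natCast]
    rw [show (1 : ℤ) + y - k - n + n = 1 + y - k by ring,
      show (1 : ℤ) + N - y + m + n - n = 1 + N - y + m by ring]
    have e2 : ((-1 : ℂ) ^ n)⁻¹ = (-1) ^ n := by rw [← inv_pow]; norm_num
    simp only [div_eq_mul_inv, mul_inv, inv_inv, e2]
    ring

end GamData

end QRacah2
end

/-! ### Moments against the product basis -/

noncomputable section

namespace QRacah2

namespace GamData

variable {h a g p c : ℂ} (E : GamData h a g p c)

local notation "Q" => rfact h

/-- Sears on the `i`-sum, interchange, `6φ5` in `x`, then Saalschütz in `i`. The outer index `j`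
enters only as an integer shift, so it is kept as a parameter in `ℤ`. -/
lemma sum_x_i (N k y m n : ℕ) (j : ℤ) (hy : y ≤ N) :
    ∑ x ∈ Finset.range (N + 1), (-1) ^ x * sh (g + p - a - c + (2 * x - N - 1) * h)
        * E.EA (x - N - 1 + k) / E.EA (x - N - 1) * E.Ed (N + 1 - x) * Q (x - k) * Q (N - x - y)
        / E.Ec (1 + y - x - n + j)
        * ∑ i ∈ Finset.range (m + 1), (-1) ^ i * Q i * Q (m - i) * E.Eg (x + i)
          * E.EA (x - N - 1 + i) * E.EB (j - (m + n) + i)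
          / (E.Eg i * E.EA (x - y - m + i) * E.EB (x + y - N - (m + n) + j + i))
      = (-1) ^ k * Q m * Q (k - m) / Q k * E.Eg k / E.Eg m * E.Ed (1 + y + m) * Q (N - y - k)
        * (E.Et (1 + N - y + m + n - j) / (E.Et (1 + k + m + n - j) * E.Ec (1 + y - k - n + j))) := by
  have hd := E.hd.ne
  have ht := E.ht.ne
  have hA := E.hA.ne
  have hB := E.hB.ne
  calc _ = ∑ x ∈ Finset.range (N + 1), ∑ i ∈ Finset.range (m + 1),
        (E.EB (j - (m + n)) * E.Ed (1 + y + m) * E.Et (1 + N - y + m + n - j) / E.Et (m + n - j)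
          * ((-1) ^ i * Q i * Q (m - i) * E.Et (m + n - j + i)
            / (E.Eg i * E.Ed (1 + y + i) * E.Et (1 + N - y + n - j + i))))
        * ((-1) ^ x * sh (g + p - a - c + (2 * x - N - 1) * h)
        * E.EA (x - N - 1 + k) / E.EA (x - y) * Q (x - k) * Q (N - x - y) * E.Eg (x + i)
        * E.Ed (N + 1 - x + i) / (E.Ec (1 + y - x - (n - j)) * E.EB (x + y - N - (n - j)))) := by
        refine Finset.sum_congr rfl fun x _ => ?_
        rw [sears_i, Finset.mul_sum, Finset.mul_sum]
        refine Finset.sum_congr rfl fun i _ => ?_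
        rw [show 1 + (y : ℤ) - x - (n - j) = 1 + y - x - n + j by ring,
          show (x : ℤ) + y - N - (n - j) = x + y - N - n + j by ring]
        have h1 := hA (x - N - 1)
        have h2 := hd (N + 1 - x)
        simp only [div_eq_mul_inv, mul_inv]
        linear_combination ((-1) ^ x * sh (g + p - a - c + (2 * x - N - 1) * h)
          * E.EA (x - N - 1 + k) * Q (x - k) * Q (N - x - y) * (E.Ec (1 + y - x - n + j))⁻¹
          * E.EB (j - (m + n)) * E.Ed (1 + y + m) * E.Et (1 + N - y + m + n - j)
          * (E.EA (x - y))⁻¹ * (E.EB (x + y - N - n + j))⁻¹ * (E.Et (m + n - j))⁻¹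
          * (-1) ^ i * Q i * Q (m - i) * E.Eg (x + i) * E.Ed (N + 1 - x + i) * E.Et (m + n - j + i)
          * (E.Eg i)⁻¹ * (E.Ed (1 + y + i))⁻¹ * (E.Et (1 + N - y + n - j + i))⁻¹)
          * (E.EA (x - N - 1) * (E.EA (x - N - 1))⁻¹ * mul_inv_cancel₀ h2 + mul_inv_cancel₀ h1)
    _ = ∑ i ∈ Finset.range (m + 1), ((-1) ^ k * E.EB (j - (m + n)) * E.Ed (1 + y + m)
          * E.Et (1 + N - y + m + n - j) * Q (N - y - k)
          / (E.Et (m + n - j) * E.Ec (1 + y - k - n + j) * E.EB (j - n)))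
          * ((-1) ^ i * Q i * Q (m - i) * E.Eg (k + i) * E.Et (m + n - j + i)
        / (E.Eg i * E.Et (1 + n - j + k + i))) := by
        rw [Finset.sum_comm]
        refine Finset.sum_congr rfl fun i _ => ?_
        rw [← Finset.mul_sum, E.sum_x N k i y _ hy]
        rw [show -((n : ℤ) - j) = j - n by ring,
          show 1 + (y : ℤ) - k - (n - j) = 1 + y - k - n + j by ring,
          show 1 + (N : ℤ) + i - y + (n - j) = 1 + N - y + n - j + i by ring,
          show 1 + (i : ℤ) + (n - j) + k = 1 + n - j + k + i by ring]
        have h1 := hd (1 + y + i)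
        have h2 := ht (1 + N - y + n - j + i)
        simp only [div_eq_mul_inv, mul_inv]
        linear_combination (E.EB (j - (m + n)) * E.Ed (1 + y + m) * E.Et (1 + N - y + m + n - j)
          * (E.Et (m + n - j))⁻¹ * (-1) ^ i * Q i * Q (m - i) * E.Et (m + n - j + i) * (E.Eg i)⁻¹
          * (-1) ^ k * Q (N - y - k) * E.Eg (k + i) * (E.Ec (1 + y - k - n + j))⁻¹
          * (E.EB (j - n))⁻¹ * (E.Et (1 + n - j + k + i))⁻¹)
          * (E.Ed (1 + y + i) * (E.Ed (1 + y + i))⁻¹ * mul_inv_cancel₀ h2 + mul_inv_cancel₀ h1)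
    _ = _ := by
        rw [← Finset.mul_sum, sum_i]
        have h1 := ht (m + n - j)
        have h2 := hB (j - n)
        have h3 := hB (j - (m + n))
        simp only [div_eq_mul_inv, mul_inv]
        linear_combination ((-1) ^ k * Q m * Q (k - m) * (Q k)⁻¹ * E.Eg k * (E.Eg m)⁻¹
          * E.Ed (1 + y + m) * Q (N - y - k) * E.Et (1 + N - y + m + n - j)
          * (E.Et (1 + k + m + n - j))⁻¹ * (E.Ec (1 + y - k - n + j))⁻¹)
          * (E.Et (m + n - j) * (E.Et (m + n - j))⁻¹ * (E.EB (j - n) * (E.EB (j - n))⁻¹)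
              * mul_inv_cancel₀ h3
            + E.Et (m + n - j) * (E.Et (m + n - j))⁻¹ * mul_inv_cancel₀ h2 + mul_inv_cancel₀ h1)

/-- The moments of the biorthogonal functions against the product basis, as an iterated sum. -/
lemma sum_y_j (N k l m n : ℕ) (hk : k ≤ N) :
    ∑ y ∈ Finset.range (N + 1), (-1) ^ y * sh (c + (2 * y - N) * h) * Q (y - l)
        * E.Ec (y - N + l) / E.Ec (y - N) * E.Ee (N - y) *
        ∑ j ∈ Finset.range (n + 1), (-1) ^ j * Q j * Q (n - j) * E.Ep (y + j) * E.Ec (y - N + j)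
          / E.Ep j
          * ((-1) ^ k * Q m * Q (k - m) / Q k * E.Eg k / E.Eg m * E.Ed (1 + y + m) * Q (N - y - k)
        * (E.Et (1 + N - y + m + n - j) / (E.Et (1 + k + m + n - j) * E.Ec (1 + y - k - n + j))))
      = (-1) ^ N * Q m * Q (k - m) * Q n * Q (l - n) * Q (N - k - l) * E.Eg k * E.Ep l
        * E.Ee (k + n) * E.Ed (1 + l + m) * E.Ea (N + m + 1 + n)
        / (Q k * Q l * E.Eg m * E.Ep n * E.Ea (m + 1 + k + l + n)) := by
  have hc := E.hc.ne
  have he := E.he.ne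
  have ht := E.ht.ne
  have ha := E.ha.ne
  calc _ = ∑ y ∈ Finset.range (N + 1), ∑ j ∈ Finset.range (n + 1),
        ((-1) ^ n * (-1) ^ k * Q m * Q (k - m) / Q k * E.Eg k / E.Eg m * E.Ee (k + n)
          * E.Ea (N + m + 1 + n) / (E.Et (1 + k + m + n) * E.Ea (k + m + n))
          * ((-1) ^ j * Q j * Q (n - j) * E.Ea (k + m + n + j)
            / (E.Ep j * E.Ee (k + j) * E.Ea (N + m + 1 + j))))
        * ((-1) ^ y * sh (c + (2 * y - N) * h) * Q (y - l) * Q (N - y - k)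
        * E.Ec (y - N + l) / E.Ec (1 + y - k) * E.Ep (y + j) * E.Ee (N - y + j)
        * E.Ed (1 + y + m) * E.Et (1 - y + N + m)) := by
        refine Finset.sum_congr rfl fun y _ => ?_
        have H := E.sears_j N k y m n
        calc _ = ((-1) ^ y * sh (c + (2 * y - N) * h) * Q (y - l)
            * E.Ec (y - N + l) / E.Ec (y - N) * E.Ee (N - y)) *
            ((-1) ^ k * Q m * Q (k - m) / Q k * E.Eg k / E.Eg m * E.Ed (1 + y + m)
              * Q (N - y - k)) *
            ∑ j ∈ Finset.range (n + 1), (-1) ^ j * Q j * Q (n - j) * E.Ep (y + j)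
              * E.Ec (y - N + j) * E.Et (1 + N - y + m + n - j)
              / (E.Ep j * E.Et (1 + k + m + n - j) * E.Ec (1 + y - k - n + j)) := by
              rw [mul_assoc (_ * E.Ee (N - y)), Finset.mul_sum _ _ (_ * Q (N - y - k))]
              congr 1
              refine Finset.sum_congr rfl fun j _ => ?_
              simp only [div_eq_mul_inv, mul_inv]
              ring
          _ = _ := by
              -- After Sears the factors `Ec (y - N)` and `Ee (N - y)` cancel against the weight,
              -- leaving the summand of `sum_y`.
              rw [H, Finset.mul_sum, Finset.mul_sum]
              refine Finset.sum_congr rfl fun j _ => ?_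
              have h1 := hc (y - N)
              have h2 := he (N - y)
              rw [show 1 - (y : ℤ) + N + m = 1 + N - y + m by ring]
              simp only [div_eq_mul_inv, mul_inv]
              linear_combination ((-1) ^ y * sh (c + (2 * y - N) * h) * Q (y - l)
                * E.Ec (y - N + l) * (-1) ^ k * Q m * Q (k - m) * (Q k)⁻¹ * E.Eg k * (E.Eg m)⁻¹
                * E.Ed (1 + y + m) * Q (N - y - k) * (-1) ^ n * E.Et (1 + N - y + m) * E.Ee (k + n)
                * E.Ea (N + m + 1 + n) * (E.Et (1 + k + m + n))⁻¹ * (E.Ec (1 + y - k))⁻¹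
                * (E.Ea (k + m + n))⁻¹ * (-1) ^ j * Q j * Q (n - j) * E.Ep (y + j)
                * E.Ee (N - y + j) * E.Ea (k + m + n + j) * (E.Ep j)⁻¹ * (E.Ee (k + j))⁻¹
                * (E.Ea (N + m + 1 + j))⁻¹)
                * (E.Ec (y - N) * (E.Ec (y - N))⁻¹ * mul_inv_cancel₀ h2 + mul_inv_cancel₀ h1)
    _ = ∑ j ∈ Finset.range (n + 1), ((-1) ^ n * (-1) ^ k * (-1) ^ (N - k) * Q m * Q (k - m) / Q k
          * E.Eg k / E.Eg m * E.Ee (k + n)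
          * E.Ea (N + m + 1 + n) / (E.Et (1 + k + m + n) * E.Ea (k + m + n)) * Q (N - k - l)
          * E.Ed (1 + l + m) * E.Et (1 + k + m)) *
          ((-1) ^ j * Q j * Q (n - j) * E.Ep (l + j) * E.Ea (k + m + n + j)
        / (E.Ep j * E.Ea (m + 1 + k + l + j))) := by
        rw [Finset.sum_comm]
        refine Finset.sum_congr rfl fun j _ => ?_
        rw [← Finset.mul_sum, E.sum_y N k l m j hk]
        have h1 := he (k + j)
        have h2 := ha (N + m + 1 + j)
        simp only [div_eq_mul_inv, mul_inv]
        linear_combination ((-1) ^ n * (-1) ^ k * Q m * Q (k - m) * (Q k)⁻¹ * E.Eg k * (E.Eg m)⁻¹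
          * E.Ee (k + n) * E.Ea (N + m + 1 + n) * (E.Et (1 + k + m + n))⁻¹ * (E.Ea (k + m + n))⁻¹
          * (-1) ^ j * Q j * Q (n - j) * E.Ea (k + m + n + j) * (E.Ep j)⁻¹ * (-1) ^ (N - k)
          * Q (N - k - l) * E.Ep (l + j) * E.Ed (1 + l + m) * E.Et (1 + k + m)
          * (E.Ea (m + 1 + k + l + j))⁻¹)
          * (E.Ee (k + j) * (E.Ee (k + j))⁻¹ * mul_inv_cancel₀ h2 + mul_inv_cancel₀ h1)
    _ = _ := by
        -- The last Saalschütz sum contributes `Q (l - n)`, and all values of `Et` cancel.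
        rw [← Finset.mul_sum, sum_j]
        have h1 := ha (k + m + n)
        have h2 := ht (1 + k + m + n)
        have h3 := ht (1 + k + m)
        have e2 : (-1 : ℂ) ^ n * (-1) ^ n = 1 := by rw [← mul_pow]; norm_num
        have e3 : (-1 : ℂ) ^ N = (-1) ^ k * (-1) ^ (N - k) := by rw [← pow_add]; congr 1; omega
        rw [e3]
        simp only [div_eq_mul_inv, mul_inv]
        linear_combination ((-1) ^ k * (-1) ^ (N - k) * Q m * Q (k - m) * Q n * Q (l - n)
          * Q (N - k - l) * E.Eg k * E.Ep l * E.Ee (k + n) * E.Ed (1 + l + m) * E.Ea (N + m + 1 + n)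
          * (Q k)⁻¹ * (Q l)⁻¹ * (E.Eg m)⁻¹ * (E.Ep n)⁻¹ * (E.Ea (m + 1 + k + l + n))⁻¹)
          * (E.Ea (k + m + n) * (E.Ea (k + m + n))⁻¹ * (E.Et (1 + k + m + n)
              * (E.Et (1 + k + m + n))⁻¹) * (E.Et (1 + k + m) * (E.Et (1 + k + m))⁻¹) * e2
            + E.Ea (k + m + n) * (E.Ea (k + m + n))⁻¹ * (E.Et (1 + k + m + n)
              * (E.Et (1 + k + m + n))⁻¹) * mul_inv_cancel₀ h3
            + E.Ea (k + m + n) * (E.Ea (k + m + n))⁻¹ * mul_inv_cancel₀ h2 + mul_inv_cancel₀ h1)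

/-- The symmetric form of the weight, up to a constant. -/
def wt (N x y : ℕ) : ℂ :=
  (-1) ^ (x + y) * sh (g + p - a - c + (2 * x - N - 1) * h) * sh (c + (2 * y - N) * h)
    * E.EA (x - N - 1) * E.Eg x * E.Ed (N + 1 - x) * E.Ec (y - N) * E.Ep y * E.Ee (N - y)
    * Q x * Q y * Q (N - x - y) / (E.Ec (1 + y - x) * E.EA (x - y) * E.EB (x + y - N))

/-- The symmetric form of `F`, up to a constant. -/
def sF (N m n x y : ℕ) : ℂ :=
  E.EB (x + y - N) * E.Ec (1 + y - x) * E.EA (x - y)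
    / (E.Eg x * E.EA (x - N - 1) * E.Ep y * E.Ec (y - N))
    * ∑ i ∈ Finset.range (m + 1), ∑ j ∈ Finset.range (n + 1),
      (-1) ^ (i + j) * Q i * Q (m - i) * Q j * Q (n - j) * E.Eg (x + i) * E.EA (x - N - 1 + i)
        * E.Ep (y + j) * E.Ec (y - N + j) * E.EB (j - (m + n) + i)
        / (E.Eg i * E.Ep j * E.EA (x - y - m + i) * E.Ec (1 + y - x - n + j)
          * E.EB (x + y - N - (m + n) + j + i))

/-- The product basis. -/
def bas (N k l x y : ℕ) : ℂ :=
  E.EA (x - N - 1 + k) / E.EA (x - N - 1) * (E.Ec (y - N + l) / E.Ec (y - N))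
    * (Q (x - k) / Q x) * (Q (y - l) / Q y)

/-- The symmetric form of `G`, up to a constant. -/
def sG (N m n x y : ℕ) : ℂ :=
  ∑ k ∈ Finset.range (m + 1), ∑ l ∈ Finset.range (n + 1),
    (-1) ^ (k + l) * Q (m - k) * Q (n - l) * Q k * Q l * E.Ea (m + n + k + l)
      / (E.Eg k * E.Ep l * E.Ee (n + k) * E.Ed (m + 1 + l) * Q (N - k - l)) * E.bas N k l x y

/-- The prefactor of `sF` and the denominators of `bas` are made to cancel against the weight;
isolating the cancellation in plain variables keeps the algebra small. -/
lemma wt_bas_aux (s a b d e q A C K L : ℂ) {q1 q2 u3 u4 u5 u6 u7 u8 u9 : ℂ} (h1 : q1 ≠ 0)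
    (h2 : q2 ≠ 0) (h3 : u3 ≠ 0) (h4 : u4 ≠ 0) (h5 : u5 ≠ 0) (h6 : u6 ≠ 0) (h7 : u7 ≠ 0)
    (h8 : u8 ≠ 0) (h9 : u9 ≠ 0) :
    s * a * b * u7 * u6 * d * u9 * u8 * e * q1 * q2 * q / (u4 * u5 * u3)
        * (u3 * u4 * u5 / (u6 * u7 * u8 * u9)) * (A / u7 * (C / u9) * (K / q1) * (L / q2))
      = s * a * b * d * e * q * (A / u7) * (C / u9) * K * L := by
  field_simp

theorem moment (N k l m n : ℕ) (hk : k ≤ N) :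
    ∑ x ∈ Finset.range (N + 1), ∑ y ∈ Finset.range (N + 1),
        E.wt N x y * E.sF N m n x y * E.bas N k l x y
      = (-1) ^ N * Q m * Q (k - m) * Q n * Q (l - n) * Q (N - k - l) * E.Eg k * E.Ep l
        * E.Ee (k + n) * E.Ed (1 + l + m) * E.Ea (N + m + 1 + n)
        / (Q k * Q l * E.Eg m * E.Ep n * E.Ea (m + 1 + k + l + n)) := by
  rw [← E.sum_y_j N k l m n hk, Finset.sum_comm]
  refine Finset.sum_congr rfl fun y hy => ?_
  have hy := Finset.mem_range.1 hy
  have hQ : ∀ k : ℕ, Q k ≠ 0 := fun k => rfact_ne E.hq (by omega)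
  -- The closed forms are unfolded back into iterated sums, so that both sides become the same
  -- fourfold sum in different orders.
  simp only [← E.sum_x_i N k y m n _ (show y ≤ N by omega)]
  have e : ∀ x : ℕ, E.wt N x y * E.sF N m n x y * E.bas N k l x y
      = ∑ i ∈ Finset.range (m + 1), ∑ j ∈ Finset.range (n + 1),
        ((-1) ^ y * sh (c + (2 * y - N) * h) * Q (y - l)
        * E.Ec (y - N + l) / E.Ec (y - N) * E.Ee (N - y)) *
        ((-1) ^ j * Q j * Q (n - j) * E.Ep (y + j) * E.Ec (y - N + j)
          / E.Ep j) * ((-1) ^ x * sh (g + p - a - c + (2 * x - N - 1) * h)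
        * E.EA (x - N - 1 + k) / E.EA (x - N - 1) * E.Ed (N + 1 - x) * Q (x - k) * Q (N - x - y)
        / E.Ec (1 + y - x - n + j)) * ((-1) ^ i * Q i * Q (m - i) * E.Eg (x + i)
          * E.EA (x - N - 1 + i) * E.EB (j - (m + n) + i)
          / (E.Eg i * E.EA (x - y - m + i) * E.EB (x + y - N - (m + n) + j + i))) := by
    intro x
    have e1 : E.wt N x y * (E.EB (x + y - N) * E.Ec (1 + y - x) * E.EA (x - y)
        / (E.Eg x * E.EA (x - N - 1) * E.Ep y * E.Ec (y - N))) * E.bas N k l x y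
      = (-1) ^ (x + y) * sh (g + p - a - c + (2 * x - N - 1) * h) * sh (c + (2 * y - N) * h)
        * E.Ed (N + 1 - x) * E.Ee (N - y) * Q (N - x - y) * (E.EA (x - N - 1 + k) / E.EA (x - N - 1))
        * (E.Ec (y - N + l) / E.Ec (y - N)) * Q (x - k) * Q (y - l) :=
      wt_bas_aux _ _ _ _ _ _ _ _ _ _ (hQ x) (hQ y) (E.hB.ne _) (E.hc.ne _) (E.hA.ne _) (E.hg.ne _)
        (E.hA.ne _) (E.hp.ne _) (E.hc.ne _)
    rw [sF, mul_right_comm, ← mul_assoc, mul_right_comm (E.wt N x y), e1, Finset.mul_sum]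
    refine Finset.sum_congr rfl fun i _ => ?_
    rw [Finset.mul_sum]
    refine Finset.sum_congr rfl fun j _ => ?_
    simp only [div_eq_mul_inv, mul_inv, pow_add]
    ring
  simp only [e, Finset.mul_sum]
  rw [Finset.sum_congr rfl fun x _ => Finset.sum_comm, Finset.sum_comm]
  refine Finset.sum_congr rfl fun j _ => ?_
  refine Finset.sum_congr rfl fun x _ => ?_
  refine Finset.sum_congr rfl fun i _ => ?_
  ring

end GamData

end QRacah2
end

/-! ### Connection coefficients and generic biorthogonality -/

noncomputable section

namespace QRacah2

namespace GamData

variable {h a g p c : ℂ} (E : GamData h a g p c)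

local notation "Q" => rfact h

/-- Saalschütz on `m ≤ k ≤ m'`. The two parameters of base `p - c` differ by `(n' - n) h`, so the
result has a factor that vanishes when `n = n'` and `m < m'`. -/
lemma connection_k (l m n m' n' : ℕ) (hm : m ≤ m') :
    ∑ k ∈ Finset.range (m' + 1), (-1) ^ k * Q (m' - k) * Q (k - m) * E.Ea (m' + n' + k + l)
        * E.Ee (k + n) / (E.Ee (n' + k) * E.Ea (m + 1 + k + l + n))
      = (-1) ^ m * Q (m' - m) * symPoch h ((n' - n) * h) (m' - m) * E.Ea (m' + n' + m + l)
        * E.Ee (m + n) * E.Ed (1 + m' + l)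
        / (E.Ed (1 + m + l) * E.Ee (n' + m') * E.Ea (m + 1 + m' + l + n)) := by
  obtain ⟨M, rfl⟩ := Nat.exists_eq_add_of_le hm
  rw [sum_range_shift _ (m + M) m (by omega) fun i hi => by
    rw [rfact_neg (n := (i : ℤ) - m) (by omega)]; ring]
  have H := saal E.hq (E.ha.shift (m + M + n' + m + l)
      (w := a + (m + M + n' + m + l) * h) (by push_cast; ring))
    (E.he.shift (m + n) (w := p - c + (m + n) * h) (by push_cast; ring))
    (E.he.shift (n' + m) (w := p - c + (n' + m) * h) (by push_cast; ring)) M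
    (E.ha.shift (m + 1 + m + l + n) (w := a + (m + 1 + m + l + n) * h) (by push_cast; ring))
    (by ring)
  rw [E.hd.symPoch_neg (1 + (m + M) + l) M (by push_cast; ring)] at H
  rw [show m + M - m + 1 = M + 1 by omega, show m + M - m = M by omega]
  have e2 : (-1 : ℂ) ^ M * (-1) ^ M = 1 := by rw [← mul_pow]; norm_num
  calc _ = (-1) ^ m * ∑ x ∈ Finset.range (M + 1), _ := ?_
    _ = _ := congrArg _ H
    _ = _ := ?_
  · rw [Finset.mul_sum]
    refine Finset.sum_congr rfl fun x _ => ?_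
    push_cast
    rw [show (m : ℤ) + M - (m + x) = M - x by ring, show (m : ℤ) + x - m = x by ring,
      show (m : ℤ) + M + n' + (m + x) + l = m + M + n' + m + l + x by ring,
      show (m : ℤ) + x + n = m + n + x by ring, show (n' : ℤ) + (m + x) = n' + m + x by ring,
      show (m : ℤ) + 1 + (m + x) + l + n = m + 1 + m + l + n + x by ring, pow_add]
    ring
  · push_cast
    rw [show (m : ℤ) + M - m = M by ring, add_zero, add_zero,
      show p - c + ((n' : ℂ) + m) * h - (p - c + (m + n) * h) = (n' - n) * h by ring,
      show 1 + ((m : ℤ) + M) + l - M = 1 + m + l by ring,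
      show (n' : ℤ) + (m + M) = n' + m + M by ring,
      show (m : ℤ) + 1 + (m + M) + l + n = m + 1 + m + l + n + M by ring]
    simp only [div_eq_mul_inv, mul_inv]
    linear_combination ((-1) ^ m * Q M * symPoch h ((n' - n) * h) M * E.Ea (m + M + n' + m + l)
        * E.Ee (m + n) * E.Ed (1 + (m + M) + l) * (E.Ed (1 + m + l))⁻¹
        * (E.Ee (n' + m + M))⁻¹ * (E.Ea (m + 1 + m + l + n + M))⁻¹) * e2

lemma symPoch_zero_left {n : ℕ} (hn : 0 < n) : symPoch h 0 n = 0 :=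
  Finset.prod_eq_zero (Finset.mem_range.2 hn) (by simp [sh_zero])

/-- An arbitrary parameter, here `g`, is inserted in numerator and denominator to make this a
Saalschütz sum; its value contains the product of base `C - B = 0` and positive length. -/
lemma connection_l (s : ℤ) (n n' : ℕ) (hn : n < n') :
    ∑ l ∈ Finset.range (n' + 1), (-1) ^ l * Q (n' - l) * Q (l - n) * E.Ea (s + n' + l)
        / E.Ea (s + 1 + n + l) = 0 := by
  obtain ⟨M, rfl⟩ := Nat.exists_eq_add_of_le hn.le
  rw [sum_range_shift _ (n + M) n (by omega) fun i hi => by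
    rw [rfact_neg (n := (i : ℤ) - n) (by omega)]; ring]
  have H := saal E.hq (E.ha.shift (s + n + M + n) (w := a + (s + n + M + n) * h)
      (by push_cast; ring)) E.hg E.hg M
    (E.ha.shift (s + 1 + n + n) (w := a + (s + 1 + n + n) * h) (by push_cast; ring)) (by ring)
  rw [sub_self, symPoch_zero_left (show 0 < M by omega), mul_zero] at H
  rw [show n + M - n + 1 = M + 1 by omega]
  calc _ = (-1) ^ n * ∑ x ∈ Finset.range (M + 1), _ := ?_
    _ = _ := congrArg _ H
    _ = _ := mul_zero _
  rw [Finset.mul_sum]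
  refine Finset.sum_congr rfl fun x _ => ?_
  have h1 := E.hg.ne x
  push_cast
  rw [show (n : ℤ) + M - (n + x) = M - x by ring, show (n : ℤ) + x - n = x by ring,
    show s + (n + M) + (n + x) = s + n + M + n + x by ring,
    show s + 1 + n + (n + x) = s + 1 + n + n + x by ring, pow_add]
  simp only [div_eq_mul_inv, mul_inv]
  linear_combination (-((-1) ^ n * (-1) ^ x * Q (M - x) * Q x * E.Ea (s + n + M + n + x)
    * (E.Ea (s + 1 + n + n + x))⁻¹)) * mul_inv_cancel₀ h1

/-- The connection coefficients between the coefficients of `sG` and the moments of `sF`. -/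
lemma connection (m n m' n' : ℕ) :
    ∑ k ∈ Finset.range (m' + 1), ∑ l ∈ Finset.range (n' + 1),
      (-1) ^ (k + l) * Q (m' - k) * Q (k - m) * Q (n' - l) * Q (l - n) * E.Ea (m' + n' + k + l)
        * E.Ee (k + n) * E.Ed (1 + l + m)
        / (E.Ee (n' + k) * E.Ed (m' + 1 + l) * E.Ea (m + 1 + k + l + n))
      = if m = m' ∧ n = n' then
          (-1) ^ (m + n) * E.Ea (m + n + m + n) / E.Ea (m + 1 + m + n + n) else 0 := by
  rcases lt_or_ge m' m with hm | hm
  · rw [if_neg (by omega)]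
    refine Finset.sum_eq_zero fun k hk => Finset.sum_eq_zero fun l _ => ?_
    have := Finset.mem_range.1 hk
    rw [rfact_neg (n := (k : ℤ) - m) (by omega)]; ring
  rcases lt_or_ge n' n with hn | hn
  · rw [if_neg (by omega)]
    refine Finset.sum_eq_zero fun k _ => Finset.sum_eq_zero fun l hl => ?_
    have := Finset.mem_range.1 hl
    rw [rfact_neg (n := (l : ℤ) - n) (by omega)]; ring
  have hd := E.hd.ne
  have e : ∀ l : ℕ, ∑ k ∈ Finset.range (m' + 1),
      (-1) ^ (k + l) * Q (m' - k) * Q (k - m) * Q (n' - l) * Q (l - n) * E.Ea (m' + n' + k + l)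
        * E.Ee (k + n) * E.Ed (1 + l + m)
        / (E.Ee (n' + k) * E.Ed (m' + 1 + l) * E.Ea (m + 1 + k + l + n))
      = ((-1) ^ m * Q (m' - m) * symPoch h ((n' - n) * h) (m' - m) * E.Ee (m + n)
          / E.Ee (n' + m')) *
        ((-1) ^ l * Q (n' - l) * Q (l - n) * E.Ea (m + m' + n' + l)
        / E.Ea (m + m' + 1 + n + l)) := by
    -- The factors `Ed` produced by the `k`-sum cancel those already present, so the remaining
    -- `l`-dependence is exactly that of `connection_l`.
    intro l
    have H := E.connection_k l m n m' n' hm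
    calc _ = ((-1) ^ l * Q (n' - l) * Q (l - n) * E.Ed (1 + m + l) / E.Ed (1 + m' + l)) *
        ∑ k ∈ Finset.range (m' + 1), _ := ?_
      _ = _ := congrArg _ H
      _ = _ := ?_
    · rw [Finset.mul_sum]
      refine Finset.sum_congr rfl fun k _ => ?_
      rw [show 1 + (m : ℤ) + l = 1 + l + m by ring, show 1 + (m' : ℤ) + l = m' + 1 + l by ring,
        pow_add]
      simp only [div_eq_mul_inv, mul_inv]
      ring
    · have h1 := hd (1 + m + l)
      have h2 := hd (1 + m' + l)
      rw [show (m : ℤ) + 1 + m' + l + n = m + m' + 1 + n + l by ring,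
        show (m' : ℤ) + n' + m + l = m + m' + n' + l by ring]
      simp only [div_eq_mul_inv, mul_inv]
      linear_combination ((-1) ^ l * Q (n' - l) * Q (l - n) * (-1) ^ m * Q (m' - m)
        * symPoch h ((n' - n) * h) (m' - m) * E.Ea (m + m' + n' + l) * E.Ee (m + n)
        * (E.Ee (n' + m'))⁻¹ * (E.Ea (m + m' + 1 + n + l))⁻¹)
        * (E.Ed (1 + m + l) * (E.Ed (1 + m + l))⁻¹ * mul_inv_cancel₀ h2 + mul_inv_cancel₀ h1)
  rw [Finset.sum_comm, Finset.sum_congr rfl fun l _ => e l, ← Finset.mul_sum]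
  -- For `n < n'` the `l`-sum vanishes; for `n = n'` and `m < m'` the coefficient from the `k`-sum
  -- does. On the diagonal only `l = n` survives.
  rcases hn.lt_or_eq with hn' | rfl
  · rw [E.connection_l _ n n' hn', mul_zero, if_neg (by omega)]
  rcases hm.lt_or_eq with hm' | rfl
  · rw [if_neg (by omega), sub_self, zero_mul, symPoch_zero_left (by omega)]; ring
  rw [if_pos ⟨rfl, rfl⟩, Finset.sum_eq_single_of_mem n (by simp) fun l hl hln => by
    have := Finset.mem_range.1 hl
    rw [rfact_neg (n := (l : ℤ) - n) (by omega)]; ring]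
  have h1 := E.he.ne (m + n)
  rw [sub_self, sub_self, sub_self, Nat.sub_self, symPoch_zero, rfact_zero, add_comm (n : ℤ) m,
    show (m : ℤ) + m + n + n = m + n + m + n by ring,
    show (m : ℤ) + m + 1 + n + n = m + 1 + m + n + n by ring, pow_add]
  simp only [div_eq_mul_inv]
  linear_combination ((-1) ^ m * (-1) ^ n * E.Ea (m + n + m + n) * (E.Ea (m + 1 + m + n + n))⁻¹)
    * mul_inv_cancel₀ h1

lemma coef_moment_aux (s s' Qa Qb Ea' Ee' Ed' Qm Qkm Qn Qln Ek El EN Em En EA : ℂ)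
    {qk ql g' p' qN : ℂ} (h1 : qk ≠ 0)
    (h2 : ql ≠ 0) (h3 : g' ≠ 0) (h4 : p' ≠ 0) (h5 : qN ≠ 0) :
    s * Qa * Qb * qk * ql * Ea' / (g' * p' * Ee' * Ed' * qN)
      * (s' * Qm * Qkm * Qn * Qln * qN * g' * p' * Ek * El * EN / (qk * ql * Em * En * EA))
      = s' * Qm * Qn * EN / (Em * En)
        * (s * Qa * Qkm * Qb * Qln * Ea' * Ek * El / (Ee' * Ed' * EA)) := by
  rw [div_mul_div_comm, div_mul_div_comm]
  have : qk * ql * g' * p' * qN ≠ 0 := by positivity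
  rw [← mul_div_mul_left _ (Em * En * _) this]
  congr 1 <;> ring

theorem biorthogonal (N m n m' n' : ℕ) (hmn' : m' + n' ≤ N) :
    ∑ x ∈ Finset.range (N + 1), ∑ y ∈ Finset.range (N + 1),
        E.wt N x y * E.sF N m n x y * E.sG N m' n' x y
      = (-1) ^ N * Q m * Q n * E.Ea (N + m + 1 + n) / (E.Eg m * E.Ep n)
        * if m = m' ∧ n = n' then
          (-1) ^ (m + n) * E.Ea (m + n + m + n) / E.Ea (m + 1 + m + n + n) else 0 := by
  have hQ : ∀ k : ℕ, Q k ≠ 0 := fun k => rfact_ne E.hq (by omega)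
  rw [← E.connection, Finset.mul_sum]
  simp only [sG, Finset.mul_sum]
  rw [Finset.sum_congr rfl fun x _ => Finset.sum_comm, Finset.sum_comm]
  refine Finset.sum_congr rfl fun k hk => ?_
  rw [Finset.sum_congr rfl fun x _ => Finset.sum_comm, Finset.sum_comm]
  refine Finset.sum_congr rfl fun l hl => ?_
  have hk := Finset.mem_range.1 hk
  have hl := Finset.mem_range.1 hl
  -- Here `m' + n' ≤ N` is essential: it gives `k + l ≤ N`, so `Q (N - k - l)` in the denominator of
  -- the coefficient of `G` is nonzero and cancels against the moment.
  rw [← coef_moment_aux _ _ _ _ _ _ _ _ _ _ _ _ _ _ _ _ _ (hQ k) (hQ l) (E.hg.ne k) (E.hp.ne l)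
    (rfact_ne E.hq (show (0 : ℤ) ≤ N - k - l by omega)), ← E.moment N k l m n (by omega),
    Finset.mul_sum]
  refine Finset.sum_congr rfl fun x _ => ?_
  rw [Finset.mul_sum]
  refine Finset.sum_congr rfl fun y _ => ?_
  ring

end GamData

end QRacah2
end

/-! ### Translation between `q`-shifted factorials and gamma sequences -/

noncomputable section

namespace QRacah2

open Complex (I)
open Real (pi)

/-- `z ↦ exp (2 z)`, turning the symmetric parameters into the original ones. -/
def ex (z : ℂ) : ℂ := Complex.exp (2 * z)

lemma ex_mul (z w : ℂ) : ex z * ex w = ex (z + w) := by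
  simp only [ex, ← Complex.exp_add]; ring_nf

lemma ex_div (z w : ℂ) : ex z / ex w = ex (z - w) := by
  simp only [ex, ← Complex.exp_sub]; ring_nf

lemma one_div_ex (w : ℂ) : 1 / ex w = ex (-w) := by
  simp only [ex, one_div, ← Complex.exp_neg]; ring_nf

lemma ex_zpow (z : ℂ) (n : ℤ) : ex z ^ n = ex (n * z) := by
  simp only [ex, ← Complex.exp_int_mul]; ring_nf

lemma ex_pow (z : ℂ) (n : ℕ) : ex z ^ n = ex (n * z) := by
  simp only [ex, ← Complex.exp_nat_mul]; ring_nf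

lemma exp_int_mul_pi (k : ℤ) : Complex.exp (k * (pi * I)) = (-1) ^ k := by
  rw [Complex.exp_int_mul, Complex.exp_pi_mul_I]

/-- The sign is written as `exp (π i)`, so every identity among prefactors becomes an equality of
exponents. -/
lemma one_sub_ex (z : ℂ) : 1 - ex z = Complex.exp (z + pi * I) * sh z := by
  rw [Complex.exp_add, Complex.exp_pi_mul_I, sh, ex, two_mul, Complex.exp_add]
  have : Complex.exp z * Complex.exp (-z) = 1 := by rw [← Complex.exp_add]; simp
  linear_combination -this

/-- The exponential factor relating the two kinds of shifted factorials. -/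
def pw (h z : ℂ) (n : ℤ) : ℂ := Complex.exp (n * z + n * (n - 1) / 2 * h)

variable {h z : ℂ} {f : ℤ → ℂ}

lemma qPoch_ex (z : ℂ) (n : ℕ) :
    qPoch (ex z) (ex h) n = pw h (z + pi * I) n * symPoch h z n := by
  induction n with
  | zero => simp [qPoch, pw, symPoch]
  | succ n ih =>
    rw [qPoch, Finset.prod_range_succ, symPoch_succ, ex_pow, ex_mul, one_sub_ex]
    rw [qPoch] at ih
    rw [ih, pw, pw]
    have : Complex.exp (((n : ℕ) : ℤ) * (z + pi * I) + ((n : ℕ) : ℤ) * (((n : ℕ) : ℤ) - 1) / 2 * h)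
        * Complex.exp (z + n * h + pi * I) = Complex.exp (((n + 1 : ℕ) : ℤ) * (z + pi * I)
          + ((n + 1 : ℕ) : ℤ) * (((n + 1 : ℕ) : ℤ) - 1) / 2 * h) := by
      rw [← Complex.exp_add]; congr 1; push_cast; ring
    rw [← this]; ring

lemma pw_neg (z : ℂ) (n : ℤ) : pw h (z + pi * I) n * (-1) ^ n = pw h z n := by
  have h1 := exp_int_mul_pi (-n)
  rw [zpow_neg, ← inv_zpow] at h1
  rw [show (-1 : ℂ) = (-1)⁻¹ by norm_num, ← h1, pw, pw, ← Complex.exp_add]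
  congr 1; push_cast; ring

lemma qPoch_gam {A : ℂ} (hf : IsGam h z f) (j : ℤ) (n : ℕ) (hA : A = ex (z + j * h)) :
    qPoch A (ex h) n = pw h (z + j * h + pi * I) n * (f (j + n) / f j) := by
  rw [hA, qPoch_ex, hf.symPoch_shift j n rfl]

lemma qPoch_gam_neg {A : ℂ} (hf : IsGam h z f) (j : ℤ) (n : ℕ) (hA : A = ex (-z + (1 - j) * h)) :
    qPoch A (ex h) n = pw h (-z + (1 - j) * h) n * (f j / f (j - n)) := by
  rw [hA, qPoch_ex, hf.symPoch_neg j n rfl, ← pw_neg (-z + (1 - j) * h), zpow_natCast]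
  ring

lemma qPoch_self (n : ℕ) : qPoch (ex h) (ex h) n = pw h (h + pi * I) n * (rfact h n)⁻¹ := by
  rw [qPoch_ex, rfact, if_neg (by omega), inv_inv, Int.toNat_natCast]

lemma qPoch_neg_pow (hq : ∀ k : ℕ, 1 ≤ k → sh (k * h) ≠ 0) (m i : ℕ) :
    qPoch (ex h ^ (-(m : ℤ))) (ex h) i
      = pw h (-(m * h)) i * (rfact h (m - i) / rfact h m) := by
  rw [ex_zpow, show ((-(m : ℤ) : ℤ) : ℂ) * h = -(m * h) by push_cast; ring, qPoch_ex,
    symPoch_neg_nat hq, ← pw_neg (-(m * h)), zpow_natCast]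
  ring

lemma qPochZ_gam {A : ℂ} (hf : IsGam h z f) (n : ℤ) (hA : A = ex z) :
    qPochZ A (ex h) n = pw h (z + pi * I) n * (f n / f 0) := by
  subst hA
  rcases n with n | n
  · have := qPoch_gam hf 0 n (A := ex z) (by simp)
    simp only [Int.cast_zero, zero_mul, add_zero, zero_add] at this
    exact this
  · have := qPoch_gam hf (-((n : ℤ) + 1)) (n + 1) (A := ex z * ex h ^ (-((n : ℤ) + 1)))
      (by rw [ex_zpow, ex_mul])
    change 1 / qPoch _ _ _ = _
    rw [this, Int.negSucc_eq]
    rw [show -((n : ℤ) + 1) + (n + 1 : ℕ) = 0 by push_cast; ring, one_div, mul_inv, inv_div]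
    congr 1
    rw [pw, pw, ← Complex.exp_neg]
    congr 1; push_cast; ring

lemma qPochZ_gam_neg {A : ℂ} (hf : IsGam h z f) (n : ℤ) (hA : A = ex (-z)) :
    qPochZ A (ex h) n = pw h (-z) n * (f 1 / f (1 - n)) := by
  rw [qPochZ_gam (hf.neg 1 (w := -z) (by push_cast; ring)) n hA, ← pw_neg (-z)]
  simp only [sub_zero, zpow_zero]
  rw [one_div, div_inv_eq_mul]; ring

namespace GamData

variable {h a g p c : ℂ} (E : GamData h a g p c)

local notation "Q" => rfact h

lemma G_eq (N m n x y : ℕ) :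
    G (ex h) (ex a) (ex g) (ex p) (ex c) N m n x y
      = E.Ee n * E.Ed (m + 1) * Q N / (Q m * Q n * E.Ea (m + n)) * E.sG N m n x y := by
  rw [G, sG, Finset.mul_sum]
  refine Finset.sum_congr rfl fun i _ => ?_
  rw [Finset.mul_sum]
  refine Finset.sum_congr rfl fun j _ => ?_
  simp only [qPochs, List.map_cons, List.map_nil, List.prod_cons, List.prod_nil, mul_one]
  rw [qPoch_neg_pow E.hq, qPoch_neg_pow E.hq, qPoch_neg_pow E.hq, qPoch_neg_pow E.hq,
    qPoch_neg_pow E.hq, qPoch_self, qPoch_self,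
    qPoch_gam E.hA (x - N - 1) i
      (by simp only [ex_mul, ex_div, ex_zpow]; congr 1; push_cast; ring),
    qPoch_gam E.hc (y - N) j (by simp only [ex_mul, ex_zpow]),
    qPoch_gam E.ha (m + n) (i + j) (by simp only [ex_mul, ex_pow]; push_cast; rfl),
    qPoch_gam E.hg 0 i (by congr 1; push_cast; ring),
    qPoch_gam E.hp 0 j (by congr 1; push_cast; ring),
    qPoch_gam E.he n i (by simp only [ex_mul, ex_div, ex_pow]; congr 1; push_cast; ring),
    qPoch_gam E.hd (m + 1) j (by simp only [ex_mul, ex_div, ex_pow]; congr 1; push_cast; ring),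
    E.hg0, E.hp0]
  -- All exponential prefactors of a summand collapse to a sign. Exponents are compared exactly, not
  -- modulo `2 π i`; hence the sign enters as `exp (-(i + j) π i)`.
  have hP : pw h (-(m * h)) i * (pw h (-(x * h)) i
        * pw h (g + p - a - c + (x - N - 1 : ℤ) * h + pi * I) i)
      * (pw h (-(n * h)) j * (pw h (-(y * h)) j * pw h (c + (y - N : ℤ) * h + pi * I) j))
      * pw h (a + (m + n : ℤ) * h + pi * I) (i + j : ℕ)
      / (pw h (h + pi * I) i * (pw h (g + (0 : ℤ) * h + pi * I) i
          * pw h (p - c + (n : ℤ) * h + pi * I) i)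
        * (pw h (h + pi * I) j * (pw h (p + (0 : ℤ) * h + pi * I) j
          * pw h (a + c - p + (m + 1 : ℤ) * h + pi * I) j))
        * pw h (-(N * h)) (i + j : ℕ)) * ex h ^ (i + j) = (-1) ^ (i + j) := by
    have e := exp_int_mul_pi (-(i + j : ℕ))
    rw [zpow_neg, ← inv_zpow, zpow_natCast, show (-1 : ℂ)⁻¹ = -1 by norm_num] at e
    rw [← e, ex_pow]
    simp only [pw, ex, ← Complex.exp_add, ← Complex.exp_sub]
    congr 1; push_cast; ring
  rw [← hP, bas]
  push_cast
  rw [show (m : ℤ) + n + (i + j) = m + n + i + j by ring,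
    show (N : ℤ) - (i + j) = N - i - j by ring, zero_add, zero_add]
  simp only [div_eq_mul_inv, mul_inv, inv_inv]
  ring

lemma F_eq (N m n x y : ℕ) :
    F (ex h) (ex a) (ex g) (ex p) (ex c) N m n x y
      = ex (m * (-(g + p - a) + (N + 1) * h) + n * N * h + m * n * h)
        * (E.EA (-n) * E.Ec (1 - m) * Q N
          / (E.Ec 1 * Q (N - m - n) * Q m * Q n * E.EB (-(m + n)))) * E.sF N m n x y := by
  rw [F]
  simp only [qPochs, List.map_cons, List.map_nil, List.prod_cons, List.prod_nil, mul_one]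
  rw [qPoch_gam_neg E.hB (x + y - N) (m + n)
      (by simp only [ex_mul, ex_div, ex_zpow]; congr 1; push_cast; ring),
    qPoch_gam_neg E.hc (1 + y - x) n
      (by simp only [ex_div, ex_zpow]; congr 1; push_cast; ring),
    qPoch_gam_neg E.hA (x - y) m
      (by simp only [ex_mul, ex_div, ex_zpow]; congr 1; push_cast; ring),
    qPoch_neg_pow E.hq,
    qPoch_gam_neg E.hA 0 n (by simp only [ex_mul, ex_div]; congr 1; push_cast; ring),
    qPoch_gam_neg E.hc 1 m (by simp only [one_div_ex]; congr 1; push_cast; ring), E.hA0]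
  have hS : ∀ i j : ℕ,
      qPoch (ex h ^ (-(m : ℤ))) (ex h) i * (qPoch (ex g * ex h ^ x) (ex h) i
            * qPoch (ex g * ex p * ex h ^ ((x : ℤ) - N - 1) / (ex a * ex c)) (ex h) i)
          * (qPoch (ex h ^ (-(n : ℤ))) (ex h) j * (qPoch (ex p * ex h ^ y) (ex h) j
            * qPoch (ex c * ex h ^ ((y : ℤ) - N)) (ex h) j))
          * qPoch (ex g * ex p * ex h ^ (-(m : ℤ) - n) / ex a) (ex h) (i + j)
        / (qPoch (ex h) (ex h) i * (qPoch (ex g) (ex h) i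
            * qPoch (ex g * ex p * ex h ^ ((x : ℤ) - y - m) / (ex a * ex c)) (ex h) i)
          * (qPoch (ex h) (ex h) j * (qPoch (ex p) (ex h) j
            * qPoch (ex c * ex h ^ (1 + (y : ℤ) - x - n)) (ex h) j))
          * qPoch (ex g * ex p * ex h ^ ((x : ℤ) + y - N - m - n) / ex a) (ex h) (i + j))
        * ex h ^ (i + j)
      = E.EA (x - y - m) * E.Ec (1 + y - x - n) * E.EB (x + y - N - (m + n))
        / (Q m * Q n * E.EB (-(m + n)) * (E.Eg x * E.EA (x - N - 1) * E.Ep y * E.Ec (y - N)))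
        * ((-1) ^ (i + j) * Q i * Q (m - i) * Q j * Q (n - j) * E.Eg (x + i) * E.EA (x - N - 1 + i)
        * E.Ep (y + j) * E.Ec (y - N + j) * E.EB (j - (m + n) + i)
        / (E.Eg i * E.Ep j * E.EA (x - y - m + i) * E.Ec (1 + y - x - n + j)
          * E.EB (x + y - N - (m + n) + j + i))) := by
    intro i j
    rw [qPoch_neg_pow E.hq, qPoch_neg_pow E.hq, qPoch_self, qPoch_self,
      qPoch_gam E.hg x i (by simp only [ex_mul, ex_pow]; push_cast; rfl),
      qPoch_gam E.hA (x - N - 1) i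
        (by simp only [ex_mul, ex_div, ex_zpow]; congr 1; push_cast; ring),
      qPoch_gam E.hp y j (by simp only [ex_mul, ex_pow]; push_cast; rfl),
      qPoch_gam E.hc (y - N) j (by simp only [ex_mul, ex_zpow]),
      qPoch_gam E.hB (-(m + n)) (i + j)
        (by simp only [ex_mul, ex_div, ex_zpow]; congr 1; push_cast; ring),
      qPoch_gam E.hg 0 i (by simp),
      qPoch_gam E.hA (x - y - m) i
        (by simp only [ex_mul, ex_div, ex_zpow]; congr 1; push_cast; ring),
      qPoch_gam E.hp 0 j (by simp),
      qPoch_gam E.hc (1 + y - x - n) j (by simp only [ex_mul, ex_zpow]),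
      qPoch_gam E.hB (x + y - N - (m + n)) (i + j)
        (by simp only [ex_mul, ex_div, ex_zpow]; congr 1; push_cast; ring),
      E.hg0, E.hp0]
    have hP : pw h (-(m * h)) i * (pw h (g + (x : ℤ) * h + pi * I) i
          * pw h (g + p - a - c + (x - N - 1 : ℤ) * h + pi * I) i)
        * (pw h (-(n * h)) j * (pw h (p + (y : ℤ) * h + pi * I) j
          * pw h (c + (y - N : ℤ) * h + pi * I) j))
        * pw h (g + p - a + (-(m + n) : ℤ) * h + pi * I) (i + j : ℕ)
        / (pw h (h + pi * I) i * (pw h (g + (0 : ℤ) * h + pi * I) i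
            * pw h (g + p - a - c + (x - y - m : ℤ) * h + pi * I) i)
          * (pw h (h + pi * I) j * (pw h (p + (0 : ℤ) * h + pi * I) j
            * pw h (c + (1 + y - x - n : ℤ) * h + pi * I) j))
          * pw h (g + p - a + (x + y - N - (m + n) : ℤ) * h + pi * I) (i + j : ℕ)) * ex h ^ (i + j)
        = (-1) ^ (i + j) := by
      have e := exp_int_mul_pi (-(i + j : ℕ))
      rw [zpow_neg, ← inv_zpow, zpow_natCast, show (-1 : ℂ)⁻¹ = -1 by norm_num] at e
      rw [← e, ex_pow]
      simp only [pw, ex, ← Complex.exp_add, ← Complex.exp_sub]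
      congr 1; push_cast; ring
    rw [← hP]
    push_cast
    rw [show (j : ℤ) - (m + n) + i = -(m + n) + (i + j) by ring,
      show (x : ℤ) + y - N - (m + n) + j + i = x + y - N - (m + n) + (i + j) by ring, zero_add,
      zero_add]
    simp only [div_eq_mul_inv, mul_inv, inv_inv]
    ring
  simp only [hS, ← Finset.mul_sum]
  rw [sF]
  have h1 := E.hB.ne (x + y - N - (m + n))
  have h2 := E.hc.ne (1 + y - x - n)
  have h3 := E.hA.ne (x - y - m)
  -- The powers `c^{n-m} q^{mx+ny+mn}` in `F` are what makes the total prefactor independent of `x`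
  -- and `y`. The same constant reappears in `nu_eq`.
  have hP : pw h (-(g + p - a) + (1 - (x + y - N : ℤ)) * h) (m + n : ℕ)
        * pw h (-c + (1 - (1 + y - x : ℤ)) * h) n
        * pw h (-(g + p - a - c) + (1 - (x - y : ℤ)) * h) m
      / (pw h (-(N * h)) (m + n : ℕ) * pw h (-(g + p - a - c) + (1 - (0 : ℤ)) * h) n
        * pw h (-c + (1 - (1 : ℤ)) * h) m) * ex c ^ ((n : ℤ) - m) * ex h ^ (m * x + n * y + m * n)
      = ex (m * (-(g + p - a) + (N + 1) * h) + n * N * h + m * n * h) := by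
    rw [ex_pow, ex_zpow]
    simp only [pw, ex, ← Complex.exp_add, ← Complex.exp_sub]
    congr 1; push_cast; ring
  rw [← hP]
  push_cast
  rw [show (N : ℤ) - (m + n) = N - m - n by ring, zero_sub]
  generalize Finset.sum (M := ℂ) (Finset.range (m + 1)) _ = S
  simp only [div_eq_mul_inv, mul_inv, inv_inv]
  linear_combination (pw h (-(g + p - a) + (1 - (x + y - N)) * h) (m + n)
        * pw h (-c + (1 - (1 + y - x)) * h) n
        * pw h (-(g + p - a - c) + (1 - (x - y)) * h) m
      * (pw h (-(N * h)) (m + n))⁻¹ * (pw h (-(g + p - a - c) + (1 - 0) * h) n)⁻¹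
        * (pw h (-c + (1 - 1) * h) m)⁻¹ * ex c ^ ((n : ℤ) - m) * ex h ^ (m * x + n * y + m * n)
      * (E.EA (-n) * E.Ec (1 - m) * Q N * (E.Ec 1)⁻¹ * (Q (N - m - n))⁻¹ * (Q m)⁻¹ * (Q n)⁻¹
      * (E.EB (-(m + n)))⁻¹) * E.EB (x + y - N) * E.Ec (1 + y - x) * E.EA (x - y)
      * (E.Eg x)⁻¹ * (E.EA (x - N - 1))⁻¹ * (E.Ep y)⁻¹ * (E.Ec (y - N))⁻¹ * S)
      * (E.EA (x - y - m) * (E.EA (x - y - m))⁻¹ * (E.Ec (1 + y - x - n)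
        * (E.Ec (1 + y - x - n))⁻¹) * mul_inv_cancel₀ h1
        + E.EA (x - y - m) * (E.EA (x - y - m))⁻¹ * mul_inv_cancel₀ h2 + mul_inv_cancel₀ h3)

lemma nu_eq (N m n : ℕ) :
    nu (ex h) (ex a) (ex g) (ex p) (ex c) N m n
      = ex (m * (-(g + p - a) + (N + 1) * h) + n * N * h + m * n * h)
        * ((-1) ^ (m + n) * E.Ea 1 * E.Ea (m + n + m + n) * E.Ed (m + 1) * E.Ee n
          * E.Ea (N + m + 1 + n) * E.Ec (1 - m) * E.EA (-n) * Q N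
          / (E.Ea (m + 1 + m + n + n) * Q m * E.Ed 1 * Q n * E.EB (-(m + n)) * E.Ea (N + 1) * E.Eg m
            * E.Ec 1 * E.Ep n * E.Ea (m + n) * Q (N - m - n))) := by
  rw [nu]
  simp only [qPochs, List.map_cons, List.map_nil, List.prod_cons, List.prod_nil, mul_one]
  rw [qPoch_self, qPoch_self,
    qPoch_gam E.hd 1 m (by simp only [ex_mul, ex_div]; congr 1; push_cast; ring),
    qPoch_gam E.he 0 n (by simp only [ex_div]; congr 1; push_cast; ring),
    qPoch_gam_neg E.hB 0 (m + n) (by simp only [ex_mul, ex_div]; congr 1; push_cast; ring),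
    qPoch_gam E.ha (N + 1) (m + n) (by simp [ex_mul, ex_pow]),
    qPoch_gam E.hg 0 m (by simp),
    qPoch_gam_neg E.hc 1 m (by simp only [one_div_ex]; congr 1; push_cast; ring),
    qPoch_gam E.hp 0 n (by simp),
    qPoch_gam_neg E.hA 0 n (by simp only [ex_mul, ex_div]; congr 1; push_cast; ring),
    qPoch_gam E.ha 0 (m + n) (by simp), qPoch_neg_pow E.hq, ex_pow, ex_mul, one_sub_ex, one_sub_ex,
    E.hg0, E.hp0, E.he0, E.hA0, E.hB0]
  -- The factor `(1 - α) / (1 - α q^{2m+2n})` is absorbed through quotients of consecutive values of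
  -- `Ea`.
  have s1 := E.ha.succ 0
  have s2 := E.ha.succ (m + n + m + n)
  rw [show a + ((0 : ℤ) : ℂ) * h = a by simp, zero_add] at s1
  rw [show a + ((m + n + m + n : ℤ) : ℂ) * h = a + ((2 * m + 2 * n : ℕ) : ℂ) * h by
    push_cast; ring, show (m : ℤ) + n + m + n + 1 = m + 1 + m + n + n by ring] at s2
  have h1 := E.ha.ne 0
  have h2 := E.ha.ne (m + n + m + n)
  rw [s1, s2]
  have hP : Complex.exp (a + pi * I) / Complex.exp (a + (2 * m + 2 * n : ℕ) * h + pi * I)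
      * (pw h (h + pi * I) m * pw h (a + c - p + (1 : ℤ) * h + pi * I) m
        * (pw h (h + pi * I) n * pw h (p - c + (0 : ℤ) * h + pi * I) n)
        * (pw h (-(g + p - a) + (1 - (0 : ℤ)) * h) (m + n : ℕ)
          * pw h (a + (N + 1 : ℤ) * h + pi * I) (m + n : ℕ))
        / (pw h (g + (0 : ℤ) * h + pi * I) m * pw h (-c + (1 - (1 : ℤ)) * h) m
          * (pw h (p + (0 : ℤ) * h + pi * I) n
            * pw h (-(g + p - a - c) + (1 - (0 : ℤ)) * h) n)
          * (pw h (a + (0 : ℤ) * h + pi * I) (m + n : ℕ) * pw h (-(N * h)) (m + n : ℕ))))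
      * ex c ^ ((n : ℤ) - m) * ex h ^ (m * n)
      = ex (m * (-(g + p - a) + (N + 1) * h) + n * N * h + m * n * h) * (-1) ^ (m + n) := by
    have e := exp_int_mul_pi (m + n : ℕ)
    rw [zpow_natCast] at e
    rw [← e, ex_pow, ex_zpow]
    simp only [pw, ex, ← Complex.exp_add, ← Complex.exp_sub]
    congr 1; push_cast; ring
  have h3 : sh (a + (2 * m + 2 * n : ℕ) * h) ≠ 0 :=
    left_ne_zero_of_mul (s2 ▸ E.ha.ne _)
  push_cast at hP h3 ⊢
  rw [show (N : ℤ) - (m + n) = N - m - n by ring, add_comm (1 : ℤ) m,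
    show (N : ℤ) + 1 + (m + n) = N + m + 1 + n by ring]
  simp only [zero_sub, zero_add]
  generalize sh (a + (2 * (m : ℂ) + 2 * n) * h) = t at *
  simp only [div_eq_mul_inv, mul_inv, inv_inv, inv_one, mul_one, one_mul] at hP ⊢
  linear_combination (sh a * t⁻¹ * (Q m)⁻¹ * (E.Ed (m + 1)) * (E.Ed 1)⁻¹ * (Q n)⁻¹ * E.Ee n
    * (E.EB (-(m + n)))⁻¹ * E.Ea (N + m + 1 + n) * (E.Ea (N + 1))⁻¹ * (E.Eg m)⁻¹ * E.Ec (1 - m)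
    * (E.Ec 1)⁻¹ * (E.Ep n)⁻¹ * E.EA (-n) * E.Ea 0 * (E.Ea (m + n))⁻¹ * Q N * (Q (N - m - n))⁻¹)
    * (hP - (ex (m * (-(g + p - a) + (N + 1) * h) + n * N * h + m * n * h) * (-1) ^ (m + n))
      * mul_inv_cancel₀ h2)

lemma weight_aux (S1 S2 gx dx py ey cxy Axy Ax cy Qxy Bxy a1 : ℂ) {t1 t2 A0 c0 B0 e d d1 a1' c1
    Qx Qy QN : ℂ} (h1 : t1 ≠ 0) (h2 : t2 ≠ 0) (h3 : A0 ≠ 0) (h4 : c0 ≠ 0) (h5 : B0 ≠ 0) (h6 : e ≠ 0)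
    (h7 : d ≠ 0) (h8 : d1 ≠ 0) (h9 : a1' ≠ 0) (h10 : c1 ≠ 0) (h11 : Qx ≠ 0) (h12 : Qy ≠ 0)
    (h13 : QN ≠ 0) (h14 : dx ≠ 0) (h15 : ey ≠ 0) (h16 : cxy ≠ 0) (h17 : Axy ≠ 0) (h18 : Bxy ≠ 0)
    (h19 : a1 ≠ 0) :
    1 / B0 * (e / 1 * (d / d1)) / (a1' / a1 * (c1 / (t2 * c0) * (1 / (t1 * A0))))
      * (S1 * S2 * (Ax / A0 * (gx / 1)) * (cy / c0 * (py / 1))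
        / (t1 * t2 * (Qx⁻¹ * (d / dx)) * (Qy⁻¹ * (e / ey))))
      * (c1 / cxy * (Qxy / QN) / (Axy / 1 * (Bxy / B0)))
    = a1 / (QN * d1 * a1') * (S1 * S2 * Ax * gx * dx * cy * py * ey * Qx * Qy * Qxy
      / (cxy * Axy * Bxy)) := by
  field_simp

lemma weight_eq (N x y : ℕ) :
    weight (ex h) (ex a) (ex g) (ex p) (ex c) N x y
      = (-1) ^ N * E.Ea 1 / (Q N * E.Ed 1 * E.Ea (N + 1)) * E.wt N x y := by
  rw [weight]
  simp only [qPochs, List.map_cons, List.map_nil, List.prod_cons, List.prod_nil, mul_one]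
  rw [qPoch_gam_neg E.hB 0 N (by simp only [ex_mul, ex_div]; congr 1; push_cast; ring),
    qPoch_gam E.he 0 N (by simp only [ex_div]; congr 1; push_cast; ring),
    qPoch_gam E.hd 1 N (by simp only [ex_mul, ex_div]; congr 1; push_cast; ring),
    qPoch_gam E.ha 1 N (by simp only [ex_mul]; congr 1; push_cast; ring),
    qPoch_gam_neg E.hc 1 N (by simp only [one_div_ex]; congr 1; push_cast; ring),
    qPoch_gam_neg E.hA 0 N (by simp only [ex_mul, ex_div]; congr 1; push_cast; ring),
    qPoch_gam E.hA (-N - 1) x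
      (by simp only [ex_mul, ex_div, ex_zpow]; congr 1; push_cast; ring),
    qPoch_gam E.hg 0 x (by simp),
    qPoch_gam E.hc (-N) y (by simp only [ex_mul, ex_zpow]),
    qPoch_gam E.hp 0 y (by simp), qPoch_self, qPoch_self,
    qPoch_gam_neg E.hd (N + 1) x
      (by simp only [ex_mul, ex_div, ex_zpow]; congr 1; push_cast; ring),
    qPoch_gam_neg E.he N y
      (by simp only [ex_mul, ex_div, ex_zpow]; congr 1; push_cast; ring),
    qPochZ_gam_neg E.hc _ (one_div_ex c), qPoch_neg_pow E.hq,
    qPochZ_gam E.hA _ (by simp only [ex_mul, ex_div]; congr 1; ring),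
    qPoch_gam E.hB (-N) (x + y)
      (by simp only [ex_mul, ex_div, ex_zpow]; congr 1; push_cast; ring),
    E.hg0, E.hp0, E.he0, E.hA0, E.hB0]
  have hx : ∀ w : ℤ, ex g * ex p * ex h ^ w / (ex a * ex c) = ex (g + p - a - c + w * h) := by
    intro w; simp only [ex_mul, ex_div, ex_zpow]; congr 1; ring
  rw [hx, hx, ex_zpow _ (2 * (y : ℤ) - N), ex_zpow _ (-(N : ℤ)), ex_mul, ex_mul, one_sub_ex,
    one_sub_ex, one_sub_ex, one_sub_ex]
  have s1 := E.hA.succ (-N - 1)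
  have s2 := E.hc.succ (-N)
  have n1 := left_ne_zero_of_mul (s1 ▸ E.hA.ne _)
  have n2 := left_ne_zero_of_mul (s2 ▸ E.hc.ne _)
  rw [sub_add_cancel] at s1
  rw [neg_add_eq_sub] at s2
  have hQ : ∀ k : ℕ, Q k ≠ 0 := fun k => rfact_ne E.hq (by omega)
  have hA := weight_aux (sh (g + p - a - c + (2 * x - N - 1 : ℤ) * h))
    (sh (c + (2 * y - N : ℤ) * h)) (E.Eg x) (E.Ed (N + 1 - x)) (E.Ep y) (E.Ee (N - y))
    (E.Ec (1 + y - x)) (E.EA (x - y)) (E.EA (x - N - 1)) (E.Ec (y - N)) (Q (N - x - y))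
    (E.EB (x + y - N)) (E.Ea 1) n1 n2 (E.hA.ne (-N - 1)) (E.hc.ne (-N)) (E.hB.ne (-N)) (E.he.ne N)
    (E.hd.ne (N + 1)) (E.hd.ne 1) (E.ha.ne (N + 1)) (E.hc.ne 1) (hQ x) (hQ y) (hQ N)
    (E.hd.ne _) (E.he.ne _) (E.hc.ne _) (E.hA.ne _) (E.hB.ne _) (E.ha.ne _)
  -- The factor `α^{-x} γ'^{x-y}` of the weight cancels the remaining exponentials, up to sign.
  have hP : pw h (-(g + p - a) + (1 - (0 : ℤ)) * h) N * (pw h (p - c + (0 : ℤ) * h + pi * I) N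
        * pw h (a + c - p + (1 : ℤ) * h + pi * I) N)
      / (pw h (a + (1 : ℤ) * h + pi * I) N * (pw h (-c + (1 - (1 : ℤ)) * h) N
        * pw h (-(g + p - a - c) + (1 - (0 : ℤ)) * h) N))
      * (Complex.exp (g + p - a - c + (2 * x - N - 1 : ℤ) * h + pi * I)
        * Complex.exp (c + (2 * y - N : ℤ) * h + pi * I)
        * (pw h (g + p - a - c + (-N - 1 : ℤ) * h + pi * I) x
          * pw h (g + (0 : ℤ) * h + pi * I) x)
        * (pw h (c + (-N : ℤ) * h + pi * I) y * pw h (p + (0 : ℤ) * h + pi * I) y)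
        / (Complex.exp (g + p - a - c + (-N - 1 : ℤ) * h + pi * I)
          * Complex.exp (c + (-N : ℤ) * h + pi * I)
          * (pw h (h + pi * I) x * pw h (-(a + c - p) + (1 - (N + 1 : ℤ)) * h) x)
          * (pw h (h + pi * I) y * pw h (-(p - c) + (1 - (N : ℤ)) * h) y)))
      * (pw h (-c) (x - y) * pw h (-(N * h)) (x + y : ℕ)
        / (pw h (g + p - a - c + pi * I) (x - y)
          * pw h (g + p - a + (-N : ℤ) * h + pi * I) (x + y : ℕ)))
      * ex a ^ (-(x : ℤ)) * ex p ^ ((x : ℤ) - y) = (-1) ^ N * (-1) ^ (x + y) := by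
    have e := exp_int_mul_pi (N + y - x)
    have e' : (-1 : ℂ) ^ (-(x : ℤ)) = (-1) ^ (x : ℤ) := by
      rw [zpow_neg, ← inv_zpow]; norm_num
    rw [sub_eq_add_neg, zpow_add₀ (by norm_num), zpow_add₀ (by norm_num), e', zpow_natCast,
      zpow_natCast, zpow_natCast, ← sub_eq_add_neg] at e
    rw [show (-1 : ℂ) ^ N * (-1) ^ (x + y) = (-1) ^ N * (-1) ^ y * (-1) ^ x by ring, ← e, ex_zpow,
      ex_zpow]
    simp only [pw, ex, ← Complex.exp_add, ← Complex.exp_sub]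
    congr 1; push_cast; ring
  refine Eq.trans ?_ ((congrArg₂ (· * ·) hP hA).trans ?_)
  · simp only [zero_sub, zero_add]
    rw [s1, s2]
    push_cast
    rw [show (1 : ℤ) - (x - y) = 1 + y - x by ring, show (N : ℤ) - (x + y) = N - x - y by ring,
      show -(N : ℤ) - 1 + x = x - N - 1 by ring, show -(N : ℤ) + y = y - N by ring,
      show -(N : ℤ) + (x + y) = x + y - N by ring, add_comm (1 : ℤ) N]
    simp only [div_eq_mul_inv, mul_inv, inv_inv, inv_one, mul_one, one_mul]
    ring
  · rw [wt]
    push_cast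
    simp only [div_eq_mul_inv, mul_inv]
    ring

/-- The biorthogonality relation for parameters in general position. -/
theorem biorthogonality (E : GamData h a g p c) (N m n m' n' : ℕ) (hmn' : m' + n' ≤ N) :
    ∑ x ∈ Finset.range (N + 1), ∑ y ∈ Finset.range (N + 1),
        weight (ex h) (ex a) (ex g) (ex p) (ex c) N x y
          * F (ex h) (ex a) (ex g) (ex p) (ex c) N m n x y
          * G (ex h) (ex a) (ex g) (ex p) (ex c) N m' n' x y
      = nu (ex h) (ex a) (ex g) (ex p) (ex c) N m n
          * (if m = m' then 1 else 0) * (if n = n' then 1 else 0) := by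
  simp only [E.weight_eq, E.F_eq, E.G_eq]
  have H := E.biorthogonal N m n m' n' hmn'
  have hQ : ∀ k : ℕ, Q k ≠ 0 := fun k => rfact_ne E.hq (by omega)
  calc _ = ((-1) ^ N * E.Ea 1 / (Q N * E.Ed 1 * E.Ea (N + 1)))
        * (ex (m * (-(g + p - a) + (N + 1) * h) + n * N * h + m * n * h)
        * (E.EA (-n) * E.Ec (1 - m) * Q N
          / (E.Ec 1 * Q (N - m - n) * Q m * Q n * E.EB (-(m + n)))))
        * (E.Ee n' * E.Ed (m' + 1) * Q N / (Q m' * Q n' * E.Ea (m' + n')))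
        * ∑ x ∈ Finset.range (N + 1), ∑ y ∈ Finset.range (N + 1),
          E.wt N x y * E.sF N m n x y * E.sG N m' n' x y := by
        rw [Finset.mul_sum]
        refine Finset.sum_congr rfl fun x _ => ?_
        rw [Finset.mul_sum]
        exact Finset.sum_congr rfl fun y _ => by ring
    _ = _ := by
        rw [H]
        by_cases h1 : m = m' ∧ n = n'
        · obtain ⟨rfl, rfl⟩ := h1
          have e1 := hQ N
          have e2 := hQ m
          have e3 := hQ n
          have e4 : (-1 : ℂ) ^ N * (-1) ^ N = 1 := by rw [← mul_pow]; norm_num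
          rw [E.nu_eq]
          simp only [and_self, if_true, mul_one, div_eq_mul_inv, mul_inv]
          linear_combination (E.Ea 1 * (E.Ed 1)⁻¹ * (E.Ea (N + 1))⁻¹
            * ex (m * (-(g + p - a) + (N + 1) * h) + n * N * h + m * n * h)
            * E.EA (-n) * E.Ec (1 - m) * (E.Ec 1)⁻¹ * (Q (N - m - n))⁻¹ * (E.EB (-(m + n)))⁻¹
            * E.Ee n * E.Ed (m + 1) * Q N * (Q m)⁻¹ * (Q n)⁻¹ * (E.Ea (m + n))⁻¹
            * E.Ea (N + m + 1 + n) * (E.Eg m)⁻¹ * (E.Ep n)⁻¹ * (-1) ^ (m + n)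
            * E.Ea (m + n + m + n) * (E.Ea (m + 1 + m + n + n))⁻¹)
            * (Q N * (Q N)⁻¹ * (Q m * (Q m)⁻¹) * (Q n * (Q n)⁻¹) * e4
              + Q N * (Q N)⁻¹ * (Q m * (Q m)⁻¹) * mul_inv_cancel₀ e3
              + Q N * (Q N)⁻¹ * mul_inv_cancel₀ e2 + mul_inv_cancel₀ e1)
        · rw [if_neg h1, mul_zero, mul_zero]
          by_cases h2 : m = m'
          · rw [if_neg (fun h3 => h1 ⟨h2, h3⟩), mul_zero]
          · rw [if_neg h2, mul_zero, zero_mul]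

end GamData

end QRacah2
end

/-! ### Nonvanishing of denominators and continuity in the parameters -/

noncomputable section

namespace QRacah2

lemma qPoch_ne {a b q : ℂ} (hq : q ≠ 0) (j : ℤ) {n : ℕ} (ha : a = b * q ^ j)
    (H : ∀ k : ℤ, j ≤ k → k < j + n → b * q ^ k ≠ 1) : qPoch a q n ≠ 0 := by
  refine Finset.prod_ne_zero_iff.2 fun k hk h0 => ?_
  rw [Finset.mem_range] at hk
  refine H (j + k) (by omega) (by omega) ?_
  rw [zpow_add₀ hq, zpow_natCast]
  rw [ha] at h0
  linear_combination -h0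

/-- For bases such as `1/c`, `q^{-N}` or `αcq/γγ'`: a factor `1 - q^k / b` vanishes exactly when `b
q^{-k} = 1`, so the exponent interval is reflected. -/
lemma qPoch_ne_of_inv {a b q : ℂ} (hq : q ≠ 0) (j : ℤ) {n : ℕ} (ha : a = q ^ j / b)
    (H : ∀ k : ℤ, -(j + n) < k → k ≤ -j → b * q ^ k ≠ 1) : qPoch a q n ≠ 0 := by
  refine qPoch_ne hq j (b := b⁻¹) (by rw [ha]; ring) fun k h1 h2 h0 => ?_
  refine H (-k) (by omega) (by omega) ?_
  rw [← inv_inj, mul_inv, zpow_neg, inv_inv, h0, inv_one]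

lemma qPochZ_ne {a q : ℂ} (hq : q ≠ 0) (n : ℤ)
    (H : ∀ k : ℤ, min n 0 ≤ k → k < max n 0 → a * q ^ k ≠ 1) : qPochZ a q n ≠ 0 := by
  cases n with
  | ofNat n =>
    exact qPoch_ne hq 0 (b := a) (by simp) fun k h1 h2 =>
      H k (by simp only [Int.ofNat_eq_natCast]; omega) (by simp only [Int.ofNat_eq_natCast]; omega)
  | negSucc n =>
    exact one_div_ne_zero (qPoch_ne hq (-((n : ℤ) + 1)) rfl fun k h1 h2 =>
      H k (by omega) (by push_cast at h2; omega))

/-- The nonvanishing conditions, uniformly with integer exponents. -/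
structure IntAdmissible (q α γ γ' c : ℂ) (N : ℕ) : Prop where
  q_ne : q ≠ 0
  alpha_ne : α ≠ 0
  gamma_ne : γ ≠ 0
  gamma'_ne : γ' ≠ 0
  c_ne : c ≠ 0
  q_pow : ∀ k : ℤ, 1 ≤ k → k ≤ N → 1 * q ^ k ≠ 1
  alpha_pow : ∀ k : ℤ, 0 ≤ k → k ≤ N → α * q ^ k ≠ 1
  alpha_pow_two : ∀ k : ℕ, k ≤ N → α * q ^ (2 * k) ≠ 1
  gamma_pow : ∀ k : ℤ, 0 ≤ k → k < N → γ * q ^ k ≠ 1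
  gamma'_pow : ∀ k : ℤ, 0 ≤ k → k < N → γ' * q ^ k ≠ 1
  gamma'_div_c : ∀ k : ℤ, 0 ≤ k → k < N → γ' / c * q ^ k ≠ 1
  alpha_c_div : ∀ k : ℤ, 1 ≤ k → k ≤ N → α * c / γ' * q ^ k ≠ 1
  gammas_div_alpha : ∀ k : ℤ, -2 * (N : ℤ) ≤ k → k < 0 → γ * γ' / α * q ^ k ≠ 1
  c_pow : ∀ k : ℤ, -2 * (N : ℤ) < k → k ≤ N → c * q ^ k ≠ 1
  c_ne_pow : c * q ^ (-(N : ℤ)) ≠ 1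
  gammas_div_alpha_c : ∀ k : ℤ, -2 * (N : ℤ) ≤ k → k < N → γ * γ' / (α * c) * q ^ k ≠ 1
  gammas_div_alpha_c_ne : γ * γ' / (α * c) * q ^ (-(N : ℤ) - 1) ≠ 1

variable {q α γ γ' c : ℂ} {N : ℕ}

lemma mul_zpow_neg_ne {b q : ℂ} (hq : q ≠ 0) {k : ℕ} (h : b ≠ q ^ k) : b * q ^ (-(k : ℤ)) ≠ 1 := by
  intro h0
  apply h
  rw [zpow_neg, zpow_natCast] at h0
  have := pow_ne_zero k hq
  field_simp at h0
  exact h0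

lemma Admissible.int (h : Admissible q α γ γ' c N) : IntAdmissible q α γ γ' c N where
  q_ne := h.q_ne
  alpha_ne := h.alpha_ne
  gamma_ne := h.gamma_ne
  gamma'_ne := h.gamma'_ne
  c_ne := h.c_ne
  q_pow k h1 h2 := by
    obtain ⟨k, rfl⟩ := Int.eq_ofNat_of_zero_le (by omega : 0 ≤ k)
    rw [one_mul, zpow_natCast]; exact h.q_pow k (by omega) (by omega)
  alpha_pow k h1 h2 := by
    obtain ⟨k, rfl⟩ := Int.eq_ofNat_of_zero_le (by omega : 0 ≤ k)
    rw [zpow_natCast]; exact h.alpha_pow k (by omega)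
  alpha_pow_two := h.alpha_pow_two
  gamma_pow k h1 h2 := by
    obtain ⟨k, rfl⟩ := Int.eq_ofNat_of_zero_le (by omega : 0 ≤ k)
    rw [zpow_natCast]; exact h.gamma_pow k (by omega)
  gamma'_pow k h1 h2 := by
    obtain ⟨k, rfl⟩ := Int.eq_ofNat_of_zero_le (by omega : 0 ≤ k)
    rw [zpow_natCast]; exact h.gamma'_pow k (by omega)
  gamma'_div_c k h1 h2 := by
    obtain ⟨k, rfl⟩ := Int.eq_ofNat_of_zero_le (by omega : 0 ≤ k)
    rw [zpow_natCast]; exact h.gamma'_div_c k (by omega)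
  alpha_c_div k h1 h2 := by
    obtain ⟨k, rfl⟩ := Int.eq_ofNat_of_zero_le (by omega : 0 ≤ k)
    rw [zpow_natCast]; exact h.alpha_c_div k (by omega) (by omega)
  gammas_div_alpha k h1 h2 := by
    obtain ⟨l, rfl⟩ : ∃ l : ℕ, k = -(l : ℤ) := ⟨(-k).toNat, by omega⟩
    exact mul_zpow_neg_ne h.q_ne (h.gammas_div_alpha l (by omega) (by omega))
  c_pow := h.c_pow
  c_ne_pow := mul_zpow_neg_ne h.q_ne h.c_ne_pow
  gammas_div_alpha_c := h.gammas_div_alpha_c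
  gammas_div_alpha_c_ne := by
    have := mul_zpow_neg_ne h.q_ne h.gammas_div_alpha_c_ne
    rwa [show -((N + 1 : ℕ) : ℤ) = -(N : ℤ) - 1 by push_cast; ring] at this

section Continuity

variable {T : Type*} [TopologicalSpace T] {t : T}

@[fun_prop]
lemma continuousAt_qPoch {a q : T → ℂ} (n : ℕ) (ha : ContinuousAt a t) (hq : ContinuousAt q t) :
    ContinuousAt (fun s => qPoch (a s) (q s) n) t := by
  unfold qPoch
  fun_prop

lemma continuousAt_qPochs_two {a b q : T → ℂ} (n : ℕ) (ha : ContinuousAt a t)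
    (hb : ContinuousAt b t) (hq : ContinuousAt q t) :
    ContinuousAt (fun s => qPochs [a s, b s] (q s) n) t := by
  simp only [qPochs, List.map_cons, List.map_nil, List.prod_cons, List.prod_nil]
  fun_prop

lemma continuousAt_qPochs_three {a b d q : T → ℂ} (n : ℕ) (ha : ContinuousAt a t)
    (hb : ContinuousAt b t) (hd : ContinuousAt d t) (hq : ContinuousAt q t) :
    ContinuousAt (fun s => qPochs [a s, b s, d s] (q s) n) t := by
  simp only [qPochs, List.map_cons, List.map_nil, List.prod_cons, List.prod_nil]
  fun_prop

lemma qPochs_two_ne {a b q : ℂ} {n : ℕ} (ha : qPoch a q n ≠ 0) (hb : qPoch b q n ≠ 0) :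
    qPochs [a, b] q n ≠ 0 := by
  simp [qPochs, ha, hb]

lemma qPochs_three_ne {a b d q : ℂ} {n : ℕ} (ha : qPoch a q n ≠ 0) (hb : qPoch b q n ≠ 0)
    (hd : qPoch d q n ≠ 0) : qPochs [a, b, d] q n ≠ 0 := by
  simp [qPochs, ha, hb, hd]

lemma continuousAt_qPochZ {a q : T → ℂ} (n : ℤ) (ha : ContinuousAt a t) (hq : ContinuousAt q t)
    (hq0 : q t ≠ 0) (H : ∀ k : ℤ, n ≤ k → k < 0 → a t * q t ^ k ≠ 1) :
    ContinuousAt (fun s => qPochZ (a s) (q s) n) t := by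
  cases n with
  | ofNat n => exact continuousAt_qPoch n ha hq
  | negSucc n =>
    refine continuousAt_const.div (continuousAt_qPoch _ (ha.mul (hq.zpow₀ _ (Or.inl hq0))) hq) ?_
    exact qPoch_ne hq0 (-((n : ℤ) + 1)) rfl fun k h1 h2 =>
      H k (by omega) (by push_cast at h2; omega)

variable {q α γ γ' c : T → ℂ}

lemma continuousAt_nu (h : IntAdmissible (q t) (α t) (γ t) (γ' t) (c t) N)
    (hq : ContinuousAt q t) (hα : ContinuousAt α t) (hγ : ContinuousAt γ t)
    (hγ' : ContinuousAt γ' t) (hc : ContinuousAt c t) {m n : ℕ} (hmn : m + n ≤ N) :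
    ContinuousAt (fun s => nu (q s) (α s) (γ s) (γ' s) (c s) N m n) t := by
  have q0 := h.q_ne
  have a0 := h.alpha_ne
  have p0 := h.gamma'_ne
  have c0 := h.c_ne
  have gp0 := mul_ne_zero h.gamma_ne p0
  have ac0 := mul_ne_zero a0 c0
  have cz (k : ℤ) : ContinuousAt (fun s => q s ^ k) t := hq.zpow₀ k (Or.inl q0)
  have cc (k : ℤ) : ContinuousAt (fun s => c s ^ k) t := hc.zpow₀ k (Or.inl c0)
  unfold nu
  refine ((ContinuousAt.mul (.div (by fun_prop) (by fun_prop) ?_) (.div ?_ ?_ ?_)).mul (cc _)).mul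
    (hq.pow _)
  · have := h.alpha_pow_two (m + n) hmn
    rw [mul_add] at this
    exact sub_ne_zero.2 this.symm
  · refine .mul (.mul ?_ ?_) ?_ <;> apply continuousAt_qPochs_two <;>
      fun_prop (disch := assumption)
  · refine .mul (.mul ?_ ?_) ?_ <;> apply continuousAt_qPochs_two <;>
      fun_prop (disch := assumption)
  · refine mul_ne_zero (mul_ne_zero ?_ ?_) ?_ <;> apply qPochs_two_ne
    · exact qPoch_ne q0 0 (by simp) fun k _ _ => h.gamma_pow k (by omega) (by omega)
    · exact qPoch_ne_of_inv q0 (b := c t) 0 (by simp) fun k _ _ => h.c_pow k (by omega) (by omega)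
    · exact qPoch_ne q0 0 (by simp) fun k _ _ => h.gamma'_pow k (by omega) (by omega)
    · refine qPoch_ne_of_inv q0 (b := γ t * γ' t / (α t * c t)) 1 ?_ fun k _ _ =>
        h.gammas_div_alpha_c k (by omega) (by omega)
      field_simp
    · exact qPoch_ne q0 0 (by simp) fun k _ _ => h.alpha_pow k (by omega) (by omega)
    · exact qPoch_ne_of_inv q0 (b := 1) (-N) (by simp) fun k _ _ =>
        h.q_pow k (by omega) (by omega)

lemma continuousAt_G (h : IntAdmissible (q t) (α t) (γ t) (γ' t) (c t) N)
    (hq : ContinuousAt q t) (hα : ContinuousAt α t) (hγ : ContinuousAt γ t)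
    (hγ' : ContinuousAt γ' t) (hc : ContinuousAt c t) {m n x y : ℕ} (hmn : m + n ≤ N) :
    ContinuousAt (fun s => G (q s) (α s) (γ s) (γ' s) (c s) N m n x y) t := by
  have q0 := h.q_ne
  have a0 := h.alpha_ne
  have p0 := h.gamma'_ne
  have c0 := h.c_ne
  have gp0 := mul_ne_zero h.gamma_ne p0
  have ac0 := mul_ne_zero a0 c0
  have cz (k : ℤ) : ContinuousAt (fun s => q s ^ k) t := hq.zpow₀ k (Or.inl q0)
  unfold G
  refine tendsto_finsetSum _ fun i hi => tendsto_finsetSum _ fun j hj => ?_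
  rw [Finset.mem_range] at hi hj
  refine ContinuousAt.mul (.div ?_ ?_ ?_) (hq.pow _)
  · refine .mul (.mul ?_ ?_) ?_
    · apply continuousAt_qPochs_three <;> fun_prop (disch := assumption)
    · apply continuousAt_qPochs_three <;> fun_prop (disch := assumption)
    · fun_prop
  · refine .mul (.mul ?_ ?_) ?_
    · apply continuousAt_qPochs_three <;> fun_prop (disch := assumption)
    · apply continuousAt_qPochs_three <;> fun_prop (disch := assumption)
    · fun_prop
  · refine mul_ne_zero (mul_ne_zero (qPochs_three_ne ?_ ?_ ?_) (qPochs_three_ne ?_ ?_ ?_)) ?_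
    · exact qPoch_ne q0 1 (by simp) fun k _ _ => h.q_pow k (by omega) (by omega)
    · exact qPoch_ne q0 0 (by simp) fun k _ _ => h.gamma_pow k (by omega) (by omega)
    · exact qPoch_ne q0 n (b := γ' t / c t) (by rw [zpow_natCast]; ring) fun k _ _ =>
        h.gamma'_div_c k (by omega) (by omega)
    · exact qPoch_ne q0 1 (by simp) fun k _ _ => h.q_pow k (by omega) (by omega)
    · exact qPoch_ne q0 0 (by simp) fun k _ _ => h.gamma'_pow k (by omega) (by omega)
    · exact qPoch_ne q0 (m + 1) (b := α t * c t / γ' t)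
        (by rw [← Nat.cast_add_one, zpow_natCast]; ring) fun k _ _ =>
        h.alpha_c_div k (by omega) (by omega)
    · exact qPoch_ne_of_inv q0 (b := 1) (-N) (by simp) fun k _ _ =>
        h.q_pow k (by omega) (by omega)

set_option maxHeartbeats 800000 in
lemma continuousAt_F (h : IntAdmissible (q t) (α t) (γ t) (γ' t) (c t) N)
    (hq : ContinuousAt q t) (hα : ContinuousAt α t) (hγ : ContinuousAt γ t)
    (hγ' : ContinuousAt γ' t) (hc : ContinuousAt c t) {m n x y : ℕ} (hmn : m + n ≤ N)
    (hxy : x + y ≤ N) :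
    ContinuousAt (fun s => F (q s) (α s) (γ s) (γ' s) (c s) N m n x y) t := by
  have q0 := h.q_ne
  have a0 := h.alpha_ne
  have p0 := h.gamma'_ne
  have c0 := h.c_ne
  have gp0 := mul_ne_zero h.gamma_ne p0
  have ac0 := mul_ne_zero a0 c0
  have cz (k : ℤ) : ContinuousAt (fun s => q s ^ k) t := hq.zpow₀ k (Or.inl q0)
  have cc (k : ℤ) : ContinuousAt (fun s => c s ^ k) t := hc.zpow₀ k (Or.inl c0)
  unfold F
  refine (((ContinuousAt.div ?_ ?_ ?_).mul (cc _)).mul (hq.pow _)).mul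
    (tendsto_finsetSum _ fun i hi => tendsto_finsetSum _ fun j hj => ?_)
  · refine .mul (.mul ?_ ?_) ?_ <;> fun_prop (disch := assumption)
  · refine .mul (.mul ?_ ?_) ?_ <;> fun_prop (disch := assumption)
  · refine mul_ne_zero (mul_ne_zero ?_ ?_) ?_
    · exact qPoch_ne_of_inv q0 (b := 1) (-N) (by simp) fun k _ _ =>
        h.q_pow k (by omega) (by omega)
    · refine qPoch_ne_of_inv q0 (b := γ t * γ' t / (α t * c t)) 1 ?_ fun k _ _ => h.gammas_div_alpha_c k (by omega) (by omega)
      field_simp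
    · exact qPoch_ne_of_inv q0 (b := c t) 0 (by simp) fun k _ _ => h.c_pow k (by omega) (by omega)
  rw [Finset.mem_range] at hi hj
  refine ContinuousAt.mul (.div ?_ ?_ ?_) (hq.pow _)
  · refine .mul (.mul ?_ ?_) ?_
    · apply continuousAt_qPochs_three <;> fun_prop (disch := assumption)
    · apply continuousAt_qPochs_three <;> fun_prop (disch := assumption)
    · fun_prop (disch := assumption)
  · refine .mul (.mul ?_ ?_) ?_
    · apply continuousAt_qPochs_three <;> fun_prop (disch := assumption)
    · apply continuousAt_qPochs_three <;> fun_prop (disch := assumption)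
    · fun_prop (disch := assumption)
  · refine mul_ne_zero (mul_ne_zero (qPochs_three_ne ?_ ?_ ?_) (qPochs_three_ne ?_ ?_ ?_)) ?_
    · exact qPoch_ne q0 1 (by simp) fun k _ _ => h.q_pow k (by omega) (by omega)
    · exact qPoch_ne q0 0 (by simp) fun k _ _ => h.gamma_pow k (by omega) (by omega)
    · exact qPoch_ne q0 _ (b := γ t * γ' t / (α t * c t)) (by ring) fun k _ _ =>
        h.gammas_div_alpha_c k (by omega) (by omega)
    · exact qPoch_ne q0 1 (by simp) fun k _ _ => h.q_pow k (by omega) (by omega)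
    · exact qPoch_ne q0 0 (by simp) fun k _ _ => h.gamma'_pow k (by omega) (by omega)
    · exact qPoch_ne q0 _ rfl fun k _ _ => h.c_pow k (by omega) (by omega)
    -- The exponents stay below `x + y - N ≤ 0` because `i + j ≤ m + n`; this is where `x + y ≤ N`
    -- is needed.
    · exact qPoch_ne q0 _ (b := γ t * γ' t / α t) (mul_div_right_comm _ _ _) fun k _ _ =>
        h.gammas_div_alpha k (by push_cast at *; omega) (by push_cast at *; omega)

set_option maxHeartbeats 800000 in
lemma continuousAt_weight (h : IntAdmissible (q t) (α t) (γ t) (γ' t) (c t) N)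
    (hq : ContinuousAt q t) (hα : ContinuousAt α t) (hγ : ContinuousAt γ t)
    (hγ' : ContinuousAt γ' t) (hc : ContinuousAt c t) {x y : ℕ} (hxy : x + y ≤ N) :
    ContinuousAt (fun s => weight (q s) (α s) (γ s) (γ' s) (c s) N x y) t := by
  have q0 := h.q_ne
  have a0 := h.alpha_ne
  have p0 := h.gamma'_ne
  have c0 := h.c_ne
  have gp0 := mul_ne_zero h.gamma_ne p0
  have ac0 := mul_ne_zero a0 c0
  have cz (k : ℤ) : ContinuousAt (fun s => q s ^ k) t := hq.zpow₀ k (Or.inl q0)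
  unfold weight
  refine (((ContinuousAt.div ?_ ?_ ?_).mul (.div ?_ ?_ ?_)).mul (.div ?_ ?_ ?_)).mul
    (hα.zpow₀ _ (Or.inl a0)) |>.mul (hγ'.zpow₀ _ (Or.inl p0))
  · apply continuousAt_qPochs_three <;> fun_prop (disch := assumption)
  · apply continuousAt_qPochs_three <;> fun_prop (disch := assumption)
  · apply qPochs_three_ne
    · exact qPoch_ne q0 1 (by simp) fun k _ _ => h.alpha_pow k (by omega) (by omega)
    · exact qPoch_ne_of_inv q0 (b := c t) 0 (by simp) fun k _ _ => h.c_pow k (by omega) (by omega)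
    · refine qPoch_ne_of_inv q0 (b := γ t * γ' t / (α t * c t)) 1 ?_ fun k _ _ => h.gammas_div_alpha_c k (by omega) (by omega)
      field_simp
  · refine .mul (.mul (.mul ?_ ?_) ?_) ?_
    · fun_prop (disch := assumption)
    · fun_prop (disch := assumption)
    · apply continuousAt_qPochs_two <;> fun_prop (disch := assumption)
    · apply continuousAt_qPochs_two <;> fun_prop (disch := assumption)
  · refine .mul (.mul (.mul ?_ ?_) ?_) ?_
    · fun_prop (disch := assumption)
    · fun_prop (disch := assumption)
    · apply continuousAt_qPochs_two <;> fun_prop (disch := assumption)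
    · apply continuousAt_qPochs_two <;> fun_prop (disch := assumption)
  · refine mul_ne_zero (mul_ne_zero (mul_ne_zero ?_ ?_) (qPochs_two_ne ?_ ?_))
      (qPochs_two_ne ?_ ?_)
    · have := h.gammas_div_alpha_c_ne
      rw [div_mul_eq_mul_div] at this
      exact sub_ne_zero.2 this.symm
    · exact sub_ne_zero.2 h.c_ne_pow.symm
    · exact qPoch_ne q0 1 (by simp) fun k _ _ => h.q_pow k (by omega) (by omega)
    · exact qPoch_ne_of_inv q0 (b := α t * c t / γ' t) (-N) (by field_simp) fun k _ _ =>
        h.alpha_c_div k (by omega) (by omega)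
    · exact qPoch_ne q0 1 (by simp) fun k _ _ => h.q_pow k (by omega) (by omega)
    · exact qPoch_ne_of_inv q0 (b := γ' t / c t) (1 - N) (by field_simp) fun k _ _ =>
        h.gamma'_div_c k (by omega) (by omega)
  -- For `x < y` the integer-index factorial is itself a reciprocal, so even this numerator needs a
  -- nonvanishing condition.
  · refine .mul (continuousAt_qPochZ _ ?_ hq q0 fun k _ _ => ?_) ?_
    · fun_prop (disch := assumption)
    · have := h.c_pow (-k) (by omega) (by omega)
      rw [zpow_neg] at this
      intro h0
      apply this
      rw [← inv_inj, mul_inv, inv_inv, inv_one, ← h0, one_div]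
    · fun_prop
  · refine .mul (continuousAt_qPochZ _ ?_ hq q0 fun k _ _ => ?_) ?_
    · fun_prop (disch := assumption)
    · exact h.gammas_div_alpha_c k (by omega) (by omega)
    · fun_prop (disch := assumption)
  · refine mul_ne_zero (qPochZ_ne q0 _ fun k _ _ => ?_) ?_
    · exact h.gammas_div_alpha_c k (by omega) (by omega)
    · exact qPoch_ne q0 (-N) (b := γ t * γ' t / α t) (mul_div_right_comm _ _ _) fun k _ _ =>
        h.gammas_div_alpha k (by omega) (by push_cast at *; omega)

end Continuity

lemma weight_eq_zero {q α γ γ' c : ℂ} {N x y : ℕ} (hq : q ≠ 0) (hxy : N < x + y) :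
    weight q α γ γ' c N x y = 0 := by
  have : qPoch (q ^ (-(N : ℤ))) q (x + y) = 0 := by
    refine Finset.prod_eq_zero (Finset.mem_range.2 hxy) ?_
    rw [zpow_neg, zpow_natCast, inv_mul_cancel₀ (pow_ne_zero _ hq), sub_self]
  rw [weight, this]
  simp

end QRacah2
end

/-! ### Density of generic parameters and passage to the limit -/

noncomputable section

namespace QRacah2

open Complex (I)
open Real (pi)

/-- When no bracket on the lattice `z + ℤ h` vanishes, the factorial continues to negative indices
by inverting the brackets passed on the way down. -/
lemma exists_isGam {h z : ℂ} (H : ∀ k : ℤ, sh (z + k * h) ≠ 0) : ∃ f, IsGam h z f ∧ f 0 = 1 := by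
  have hs (w : ℂ) (n : ℕ) :
      symPoch h w (n + 1) = sh w * symPoch h (w + h) n := by
    rw [symPoch, Finset.prod_range_succ', mul_comm, symPoch]
    congr 1
    · simp
    · refine Finset.prod_congr rfl fun k _ => ?_
      congr 1; push_cast; ring
  have hn (j : ℤ) (n : ℕ) : symPoch h (z + j * h) n ≠ 0 := by
    refine Finset.prod_ne_zero_iff.2 fun k _ => ?_
    have := H (j + k)
    rwa [show z + ((j + k : ℤ) : ℂ) * h = z + j * h + k * h by push_cast; ring] at this
  refine ⟨fun k => if 0 ≤ k then symPoch h z k.toNat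
    else (symPoch h (z + k * h) (-k).toNat)⁻¹, ⟨fun k => ?_, fun k => ?_⟩, by simp [symPoch_zero]⟩
  · split_ifs
    · simpa using hn 0 k.toNat
    · exact inv_ne_zero (hn k _)
  · rcases lt_trichotomy k (-1) with hk | rfl | hk
    · obtain ⟨n, rfl⟩ : ∃ n : ℕ, k = -(n : ℤ) - 1 := ⟨(-k - 1).toNat, by omega⟩
      rw [if_neg (by omega), if_neg (by omega), show (-(-(n : ℤ) - 1)).toNat = n + 1 by omega,
        show (-(-(n : ℤ) - 1 + 1)).toNat = n by omega, hs, mul_inv,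
        mul_inv_cancel_left₀ (H _)]
      congr 2; push_cast; ring
    · have := H (-1)
      simpa [symPoch] using (mul_inv_cancel₀ this).symm
    · obtain ⟨n, rfl⟩ : ∃ n : ℕ, k = n := ⟨k.toNat, by omega⟩
      rw [if_pos (by omega), if_pos (by omega), show ((n : ℤ) + 1).toNat = n + 1 by omega,
        symPoch_succ, Int.toNat_natCast, mul_comm, Int.cast_natCast]

lemma nonempty_gamData {h a g p c : ℂ} (hq : ∀ k : ℕ, 1 ≤ k → sh (k * h) ≠ 0)
    (H : ∀ z ∈ [a, g, p, c, p - c, a + c - p, g + p - a - c, g + p - a, a - p,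
      g + 2 * p - 2 * a - c, c - a], ∀ k : ℤ, sh (z + k * h) ≠ 0) :
    Nonempty (GamData h a g p c) := by
  simp only [List.forall_mem_cons] at H
  obtain ⟨ha, hg, hp, hc, he, hd, hA, hB, ht, hr, hs, -⟩ := H
  obtain ⟨Ea, Ha, -⟩ := exists_isGam ha
  obtain ⟨Eg, Hg, Hg0⟩ := exists_isGam hg
  obtain ⟨Ep, Hp, Hp0⟩ := exists_isGam hp
  obtain ⟨Ec, Hc, -⟩ := exists_isGam hc
  obtain ⟨Ee, He, He0⟩ := exists_isGam he
  obtain ⟨Ed, Hd, -⟩ := exists_isGam hd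
  obtain ⟨EA, HA, HA0⟩ := exists_isGam hA
  obtain ⟨EB, HB, HB0⟩ := exists_isGam hB
  obtain ⟨Et, Ht, -⟩ := exists_isGam ht
  obtain ⟨Er, Hr, -⟩ := exists_isGam hr
  obtain ⟨Es, Hs, -⟩ := exists_isGam hs
  exact ⟨⟨Ea, Eg, Ep, Ec, Ee, Ed, EA, EB, Et, Er, Es, hq, Ha, Hg, Hp, Hc, He, Hd, HA, HB, Ht, Hr,
    Hs, Hg0, Hp0, He0, HA0, HB0⟩⟩

lemma countable_sh_eq_zero (w : ℂ) {s : ℂ} (hs : s ≠ 0) : {t : ℂ | sh (w + s * t) = 0}.Countable := by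
  refine (Set.countable_range fun n : ℤ => (n * (pi * I) - w) / s).mono fun t ht => ?_
  have h1 : Complex.exp (2 * (w + s * t)) = 1 := by
    have := one_sub_ex (w + s * t)
    rw [ht, mul_zero, sub_eq_zero] at this
    exact this.symm
  obtain ⟨n, hn⟩ := Complex.exp_eq_one_iff.1 h1
  refine ⟨n, ?_⟩
  rw [div_eq_iff hs]
  linear_combination -hn / 2

lemma countable_exists_sh_eq_zero (w h : ℂ) {l : ℤ} (hl : l % 10 ≠ 0) :
    {t : ℂ | ∃ k : ℤ, sh (w + l * t + k * (h + 10 * t)) = 0}.Countable := by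
  rw [Set.ofPred_exists]
  refine Set.countable_iUnion fun k => ?_
  -- The coefficient of `t` in the argument is `l + 10 k`, nonzero for every `k` precisely because
  -- `10` does not divide `l`.
  have hs : (l : ℂ) + k * 10 ≠ 0 := by
    have : l + k * 10 ≠ 0 := by omega
    exact_mod_cast this
  refine (countable_sh_eq_zero (w + k * h) hs).mono fun t ht => ?_
  rw [Set.mem_ofPred_eq] at ht ⊢
  rw [← ht]; congr 1; ring

lemma countable_exists_sh_nat_eq_zero (h : ℂ) :
    {t : ℂ | ∃ k : ℕ, sh ((k + 1 : ℕ) * (h + 10 * t)) = 0}.Countable := by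
  rw [Set.ofPred_exists]
  refine Set.countable_iUnion fun k => ?_
  have hs : ((k + 1 : ℕ) : ℂ) * 10 ≠ 0 := mul_ne_zero (Nat.cast_ne_zero.2 (by omega)) (by norm_num)
  refine (countable_sh_eq_zero ((k + 1 : ℕ) * h) hs).mono fun t ht => ?_
  rw [Set.mem_ofPred_eq] at ht ⊢
  rw [← ht]; congr 1; ring

/-- The direction `(10, 4, 1, 2, 5)` gives the eleven bases slopes `4, 1, 2, 5, -3, 7, -6, -1, 2,
-8, 1`, none divisible by the slope `10` of `h`. Hence no required bracket vanishes identically in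
`t`, the bad set is countable, and its complement is dense in `ℂ`. -/
lemma frequently_gamData (h a g p c : ℂ) : ∃ᶠ t in nhds (0 : ℂ),
    Nonempty (GamData (h + 10 * t) (a + 4 * t) (g + t) (p + 2 * t) (c + 5 * t)) := by
  have H (w : ℂ) (l : ℤ) (hl : l % 10 ≠ 0) := countable_exists_sh_eq_zero w h hl
  have hS := (countable_exists_sh_nat_eq_zero h).union <| (H a 4 (by decide)).union <|
    (H g 1 (by decide)).union <| (H p 2 (by decide)).union <| (H c 5 (by decide)).union <|
    (H (p - c) (-3) (by decide)).union <| (H (a + c - p) 7 (by decide)).union <|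
    (H (g + p - a - c) (-6) (by decide)).union <| (H (g + p - a) (-1) (by decide)).union <|
    (H (a - p) 2 (by decide)).union <| (H (g + 2 * p - 2 * a - c) (-8) (by decide)).union
    (H (c - a) 1 (by decide))
  have hd := mem_closure_iff_frequently.1 ((hS.dense_compl ℝ) 0)
  refine hd.mono fun t ht => ?_
  simp only [Set.mem_compl_iff, Set.mem_union, Set.mem_ofPred_eq, not_or, not_exists] at ht
  obtain ⟨h0, h1, h2, h3, h4, h5, h6, h7, h8, h9, h10, h11⟩ := ht
  refine nonempty_gamData (fun k hk => ?_) ?_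
  · obtain ⟨k, rfl⟩ := Nat.exists_eq_add_of_le' hk
    exact h0 k
  · simp only [List.forall_mem_cons]
    have K {z w : ℂ} (e : w = z) (hw : ∀ k : ℤ, ¬sh (w + k * (h + 10 * t)) = 0) (k : ℤ) :
        sh (z + k * (h + 10 * t)) ≠ 0 := e ▸ hw k
    refine ⟨K ?_ h1, K ?_ h2, K ?_ h3, K ?_ h4, K ?_ h5, K ?_ h6, K ?_ h7, K ?_ h8, K ?_ h9,
      K ?_ h10, K ?_ h11, by simp⟩ <;> (push_cast; ring)

lemma exists_ex_eq {z : ℂ} (hz : z ≠ 0) : ∃ w, ex w = z :=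
  ⟨Complex.log z / 2, by rw [ex, mul_div_cancel₀ _ two_ne_zero, Complex.exp_log hz]⟩

lemma continuousAt_ex (w : ℂ) (r t : ℂ) : ContinuousAt (fun s => ex (w + r * s)) t := by
  unfold ex; fun_prop

theorem Admissible.biorthogonality {q α γ γ' c : ℂ} {N : ℕ} (h : Admissible q α γ γ' c N)
    (m n m' n' : ℕ) (hmn : m + n ≤ N) (hmn' : m' + n' ≤ N) :
    ∑ x ∈ Finset.range (N + 1), ∑ y ∈ Finset.range (N + 1),
        weight q α γ γ' c N x y * F q α γ γ' c N m n x y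
          * G q α γ γ' c N m' n' x y
      = nu q α γ γ' c N m n
          * (if m = m' then 1 else 0) * (if n = n' then 1 else 0) := by
  obtain ⟨h0, rfl⟩ := exists_ex_eq h.q_ne
  obtain ⟨a0, rfl⟩ := exists_ex_eq h.alpha_ne
  obtain ⟨g0, rfl⟩ := exists_ex_eq h.gamma_ne
  obtain ⟨p0, rfl⟩ := exists_ex_eq h.gamma'_ne
  obtain ⟨c0, rfl⟩ := exists_ex_eq h.c_ne
  have hq := continuousAt_ex h0 10 0
  have hα := continuousAt_ex a0 4 0
  have hγ := continuousAt_ex g0 1 0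
  have hγ' := continuousAt_ex p0 2 0
  have hc := continuousAt_ex c0 5 0
  have hI : IntAdmissible (ex (h0 + 10 * 0)) (ex (a0 + 4 * 0)) (ex (g0 + 1 * 0))
      (ex (p0 + 2 * 0)) (ex (c0 + 5 * 0)) N := by simpa using h.int
  have hL : ContinuousAt (fun t => ∑ x ∈ Finset.range (N + 1), ∑ y ∈ Finset.range (N + 1),
      weight (ex (h0 + 10 * t)) (ex (a0 + 4 * t)) (ex (g0 + 1 * t)) (ex (p0 + 2 * t))
        (ex (c0 + 5 * t)) N x y
      * F (ex (h0 + 10 * t)) (ex (a0 + 4 * t)) (ex (g0 + 1 * t)) (ex (p0 + 2 * t))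
        (ex (c0 + 5 * t)) N m n x y
      * G (ex (h0 + 10 * t)) (ex (a0 + 4 * t)) (ex (g0 + 1 * t)) (ex (p0 + 2 * t))
        (ex (c0 + 5 * t)) N m' n' x y) 0 := by
    refine tendsto_finsetSum _ fun x _ => tendsto_finsetSum _ fun y _ => ?_
    rcases lt_or_ge N (x + y) with hxy | hxy
    -- Outside the triangle the denominators are not controlled, so continuity of `F` is
    -- unavailable; but the weight is zero for every `t`, and so is the whole term.
    · refine (continuousAt_const (y := (0 : ℂ))).congr (.of_forall fun t => ?_)
      have h1 : ex (h0 + 10 * t) ≠ 0 := Complex.exp_ne_zero _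
      simp only [weight_eq_zero h1 hxy, zero_mul]
    · exact ((continuousAt_weight hI hq hα hγ hγ' hc hxy).mul
        (continuousAt_F hI hq hα hγ hγ' hc hmn hxy)).mul (continuousAt_G hI hq hα hγ hγ' hc hmn')
  have hR : ContinuousAt (fun t => nu (ex (h0 + 10 * t)) (ex (a0 + 4 * t)) (ex (g0 + 1 * t))
      (ex (p0 + 2 * t)) (ex (c0 + 5 * t)) N m n
      * (if m = m' then 1 else 0) * (if n = n' then 1 else 0)) 0 :=
    ((continuousAt_nu hI hq hα hγ hγ' hc hmn).mul continuousAt_const).mul continuousAt_const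
  -- Both sides are continuous at `0` and agree at points arbitrarily close to `0`, hence agree at
  -- `0`.
  have key := tendsto_nhds_unique_of_frequently_eq hL hR
    ((frequently_gamData h0 a0 g0 p0 c0).mono fun t ⟨E⟩ => by
      rw [one_mul]; exact E.biorthogonality N m n m' n' hmn')
  simpa only [mul_zero, add_zero] using key

end QRacah2
end

theorem mainTheorem3 (q α γ γ' c : ℂ) (N : ℕ) (h : QRacah2.Admissible q α γ γ' c N)
    (m n m' n' : ℕ) (hmn : m + n ≤ N) (hmn' : m' + n' ≤ N) :
    ∑ x ∈ Finset.range (N + 1), ∑ y ∈ Finset.range (N + 1),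
        QRacah2.weight q α γ γ' c N x y * QRacah2.F q α γ γ' c N m n x y
          * QRacah2.G q α γ γ' c N m' n' x y
      = QRacah2.nu q α γ γ' c N m n
          * (if m = m' then 1 else 0) * (if n = n' then 1 else 0) :=
  h.biorthogonality m n m' n' hmn hmn'
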